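/- Let $W_{Y|X}$ and $W_{Z|X}$ be binary-input discrete memoryless channels with input alphabet $\{0,1\}$ and finite output alphabets $\mathcal Y,\mathcal Z$. Here $0$ is the innocent symbol (the all-zero word is the channel input when nothing is sent). Write $P_x=W_{Y|X=x}$ (receivers' channel) and $Q_x=W_{Z|X=x}$ (warden's channel). Assume $Q_1\neq Q_0$, $Q_1\ll Q_0$ and $P_1\ll P_0$, and let $\delta>0$. All logarithms are natural. An identification code of blocklength $n$ (without shared key) consists of a nonempty finite message set $\mathcal M$, distributions $U_m$ on $\{0,1\}^n$ and (not necessarily disjoint) sets $\mathcal D_m\subseteq\mathcal Y^n$, $m\in\mathcal M$. Its error probabilities are $$P^{(1)}_{\rm err}=\max_{m}\sum_{\mathbf x}U_m(\mathbf x)W_{Y|X}^{\otimes n}(\mathcal D_m^c|\mathbf x),\quad P^{(2)}_{\rm err}=\max_{m\ne m'}\sum_{\mathbf x}U_{m'}(\mathbf x)W_{Y|X}^{\otimes n}(\mathcal D_m|\mathbf x),\quad P^{(3)}_{\rm err}=\max_m P_0^{\otimes n}(\mathcal D_m),$$ and it is $\delta$-covert if $\mathbb D(\widehat Q^n\Vert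 Q_0^{\otimes n})\le\delta$, where $\widehat Q^n(\mathbf z)=\frac1{|\mathcal M|}\sum_m\sum_{\mathbf x}U_m(\mathbf x)W_{Z|X}^{\otimes n}(\mathbf z|\mathbf x)$. Fix any strictly increasing sequence of blocklengths (for instance, all of $\mathbb N$). A rate $R\ge 0$ is $\delta$-achievable along it if there is a sequence of $\delta$-covert identification codes of these blocklengths $n$ with $\liminf_{n\to\infty}\frac{\log\log|\mathcal M|}{\sqrt n}\ge R$ (with $\log 0=-\infty$) and $P^{(1)}_{\rm err},P^{(2)}_{\rm err},P^{(3)}_{\rm err}\to0$. The $\delta$-covert identification capacity $C_\delta$ is the supremum in $[0,\infty]$ of the $\delta$-achievable rates (so it is $0$ if there are none). Then, for every choice of the sequence of blocklengths, $$C_\delta=\sqrt{\frac{2\delta}{\chi_2(Q_1\Vert Q_0)}}\;\mathbb D(P_1\Vert P_0),$$ where $\mathbb D(P\Vert Q)=\sum_a P(a)\log\frac{P(a)}{Q(a)}$ and $\chi_2(P\Vert Q)=\sum_a\frac{(P(a)-Q(a))^2}{Q(a)}$, with sums over the support of $Q$ (terms with $P(a)=0$ in $\mathbb D$ being $0$).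 -/

import Mathlib

open scoped NNReal ENNReal

noncomputable section

namespace CovertID

/-- KL divergence (natural logarithm) of two probability vectors on a finite set; the formula is
meaningful when `P` is absolutely continuous with respect to `Q` (terms with `P a = 0` vanish). -/
def klDivergence {A : Type*} [Fintype A] (P Q : A → ℝ) : ℝ :=
  ∑ a, P a * Real.log (P a / Q a)

/-- The `χ₂`-distance of two probability vectors on a finite set; the formula is meaningful when
`P` is absolutely continuous with respect to `Q` (terms with `P a = Q a = 0` vanish). -/
def chiSquare {A : Type*} [Fintype A] (P Q : A → ℝ) : ℝ :=
  ∑ a, (P a - Q a) ^ 2 / Q a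

/-- Absolute continuity `P ≪ Q` on a finite set. -/
def AbsCont {A : Type*} (P Q : A → ℝ) : Prop :=
  ∀ a, Q a = 0 → P a = 0

/-- `W` is the transition matrix of a binary-input channel with output alphabet `A`:
`W x` is the output distribution when the input symbol is `x`. -/
def IsBinaryChannel {A : Type*} [Fintype A] (W : Fin 2 → A → ℝ) : Prop :=
  ∀ x, W x ∈ stdSimplex ℝ A

/-- Transition probability of `n` memoryless uses of the channel `W`. -/
def blockChannel {A : Type*} (W : Fin 2 → A → ℝ) {n : ℕ} (x : Fin n → Fin 2) (y : Fin n → A) : ℝ :=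
  ∏ i, W (x i) (y i)

/-- The `n`-fold product of the distribution `P`. -/
def productDist {A : Type*} (P : A → ℝ) (n : ℕ) (y : Fin n → A) : ℝ :=
  ∏ i, P (y i)

/-- The mass that `p` gives to the set `S`. -/
def mass {A : Type*} [Fintype A] (p : A → ℝ) (S : Set A) : ℝ :=
  ∑ a, S.indicator p a

/-- An identification code of blocklength `n`, with a nonempty finite message set `Fin size`,
stochastic codewords (distributions on the input words, no shared key) and demapping regions,
which need not be disjoint. -/
structure IdCode (Y : Type*) (n : ℕ) where
  /-- the number of messages -/
  size : ℕ
  size_pos : 0 < size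
  /-- the input distribution of each message -/
  codeword : Fin size → (Fin n → Fin 2) → ℝ
  codeword_mem : ∀ m, codeword m ∈ stdSimplex ℝ (Fin n → Fin 2)
  /-- the demapping region of each message -/
  region : Fin size → Set (Fin n → Y)

namespace IdCode

/-- Error probability of the first kind: `m` is sent and its own receiver rejects. -/
def err1 {Y : Type*} [Fintype Y] {n : ℕ} (C : IdCode Y n) (W : Fin 2 → Y → ℝ)
    (m : Fin C.size) : ℝ :=
  ∑ x, C.codeword m x * mass (blockChannel W x) (C.region m)ᶜ

/-- Error probability of the second kind: `m'` is sent and the receiver of `m` accepts. -/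
def err2 {Y : Type*} [Fintype Y] {n : ℕ} (C : IdCode Y n) (W : Fin 2 → Y → ℝ)
    (m m' : Fin C.size) : ℝ :=
  ∑ x, C.codeword m' x * mass (blockChannel W x) (C.region m)

/-- Error probability of the third kind: nothing is sent and the receiver of `m` accepts. -/
def err3 {Y : Type*} [Fintype Y] {n : ℕ} (C : IdCode Y n) (W : Fin 2 → Y → ℝ)
    (m : Fin C.size) : ℝ :=
  mass (productDist (W 0) n) (C.region m)

/-- Maximum error probability of the first kind. -/
def maxErr1 {Y : Type*} [Fintype Y] {n : ℕ} (C : IdCode Y n) (W : Fin 2 → Y → ℝ) : ℝ :=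
  ⨆ m, C.err1 W m

/-- Maximum error probability of the second kind, over pairs of distinct messages
(`0` if there is only one message). -/
def maxErr2 {Y : Type*} [Fintype Y] {n : ℕ} (C : IdCode Y n) (W : Fin 2 → Y → ℝ) : ℝ :=
  ⨆ p : {p : Fin C.size × Fin C.size // p.1 ≠ p.2}, C.err2 W p.1.1 p.1.2

/-- Maximum error probability of the third kind. -/
def maxErr3 {Y : Type*} [Fintype Y] {n : ℕ} (C : IdCode Y n) (W : Fin 2 → Y → ℝ) : ℝ :=
  ⨆ m, C.err3 W m

/-- The warden's output distribution induced by the code when the message is uniform. -/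
def wardenOutput {Y Z : Type*} {n : ℕ} (C : IdCode Y n) (V : Fin 2 → Z → ℝ)
    (z : Fin n → Z) : ℝ :=
  (1 / (C.size : ℝ)) * ∑ m, ∑ x, C.codeword m x * blockChannel V x z

/-- `δ`-covertness of the code with respect to the warden's channel `V`. -/
def IsCovert {Y Z : Type*} [Fintype Z] {n : ℕ} (C : IdCode Y n) (V : Fin 2 → Z → ℝ)
    (δ : ℝ) : Prop :=
  klDivergence (C.wardenOutput V) (productDist (V 0) n) ≤ δ

/-- The rate `(log log |M|) / √n`, equal to `-∞` for a single message (`log 0 = -∞`). -/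
def rate {Y : Type*} {n : ℕ} (C : IdCode Y n) : EReal :=
  if C.size = 1 then ⊥ else ((Real.log (Real.log C.size) / √(n : ℝ) : ℝ) : EReal)

end IdCode

/-- The rate `R` is `δ`-achievable along the blocklengths `ν 0 < ν 1 < ν 2 < ⋯`, for the
receivers' channel `W` and the warden's channel `V`. -/
def IsAchievable {Y Z : Type*} [Fintype Y] [Fintype Z] (W : Fin 2 → Y → ℝ) (V : Fin 2 → Z → ℝ)
    (δ : ℝ) (ν : ℕ → ℕ) (R : ℝ) : Prop :=
  ∃ C : ∀ k, IdCode Y (ν k),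
    (R : EReal) ≤ Filter.liminf (fun k => (C k).rate) Filter.atTop ∧
    (∀ k, (C k).IsCovert V δ) ∧
    Filter.Tendsto (fun k => (C k).maxErr1 W) Filter.atTop (nhds 0) ∧
    Filter.Tendsto (fun k => (C k).maxErr2 W) Filter.atTop (nhds 0) ∧
    Filter.Tendsto (fun k => (C k).maxErr3 W) Filter.atTop (nhds 0)

/-- The `δ`-covert identification capacity along the blocklengths `ν`: the supremum in `[0, ∞]`
of the nonnegative `δ`-achievable rates. -/
def covertIdCapacity {Y Z : Type*} [Fintype Y] [Fintype Z] (W : Fin 2 → Y → ℝ)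
    (V : Fin 2 → Z → ℝ) (δ : ℝ) (ν : ℕ → ℕ) : ℝ≥0∞ :=
  ⨆ (R : ℝ≥0) (_ : IsAchievable W V δ ν R), (R : ℝ≥0∞)

end CovertID

end

/-!
Write `P x = W x`, `Q x = V x`, `D = 𝔻(P₁ ‖ P₀)`, `χ₂ = χ₂(Q₁ ‖ Q₀)` and `w = √(2 δ / χ₂)`. Covertness
allows about `w √n` non-innocent symbols in a word of length `n`, each of them carries information
`D` to a receiver, and an identification code has doubly exponentially many messages in the
information carried.

*Achievability.* Let the input symbols be independent and equal to `1` with probability `t / √n`,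
where `t < w`. Every message gets an independent random list of `L ≈ exp (√n (t D - ε))` words, one
of which is sent uniformly at random; its region consists of the output words whose likelihood ratio
with respect to the innocent input is large for some word of the list. The information density
concentrates around `√n t D`, a region has small mass under the innocent output distribution by a
union bound over the list, and then also under the mean output distribution, because the second
moment of the likelihood ratio of the two is bounded (`second_moment_mixOutput_le`). Chernoff's
bound over the `L` words of a list makes each error event doubly exponentially unlikely. No key and
no separate resolvability code is needed: the warden sees the average over doubly exponentially many
independent lists, which is so close to the mean output distribution that the relative entropy is
about `n 𝔻(Q_α ‖ Q₀) ≈ t² χ₂ / 2 < δ` in the mean (`mean_klDivergence_average_le`). The three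
requirements are combined into the mean of one sum of defects, which is less than one
(`exists_idCode`).

*Converse.* The Donsker–Varadhan inequality, applied to a multiple of the sum of the scores
`(Q₁ - Q₀) / Q₀`, shows that the mean weight of the words of a covert code is at most
`w √n + O(1)` (`exists_mean_weight_le`). Hence, for `a > w`, a fixed proportion of the messages each
put a fixed proportion of their mass on words of weight at most `a √n`, and conditioning on such
words multiplies the error probabilities by a constant at most. The output distribution of a conditioned
message is approximated in total variation by that of a list of `exp (√n (a D + ε))` words
(`exists_list_approx`). Messages with the same list cannot be told apart, so that there are at most
as many messages as lists, up to a constant (`size_le_of_errors_le`).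
-/

namespace CovertID

/-! ### Product distributions on finite sets -/

section Products

variable {A ι : Type*} [Fintype A] [Fintype ι] [DecidableEq ι]

theorem sum_prod_mul_apply {p : ι → A → ℝ} (hp : ∀ i, ∑ a, p i a = 1) (j : ι) (h : A → ℝ) :
    ∑ y : ι → A, (∏ i, p i (y i)) * h (y j) = ∑ a, p j a * h a := by
  have h1 : ∀ y : ι → A, (∏ i, p i (y i)) * h (y j) =
      ∏ i, (p i (y i) * if i = j then h (y i) else 1) := by
    intro y
    rw [Finset.prod_mul_distrib, Finset.prod_ite_eq']
    simp
  simp_rw [h1]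
  rw [← Fintype.prod_sum (fun i a => p i a * if i = j then h a else 1),
    Fintype.prod_eq_single j]
  · simp
  · intro i hi
    simp [hi, hp]

theorem sum_prod_eq_one {p : ι → A → ℝ} (hp : ∀ i, ∑ a, p i a = 1) :
    ∑ y : ι → A, ∏ i, p i (y i) = 1 := by
  rw [← Fintype.prod_sum p]
  simp [hp]

/-- Two distinct coordinates of a product distribution are independent. -/
theorem sum_prod_mul_apply₂ {p : ι → A → ℝ} (hp : ∀ i, ∑ a, p i a = 1) {j k : ι} (hjk : j ≠ k)
    (h : A → A → ℝ) :
    ∑ y : ι → A, (∏ i, p i (y i)) * h (y j) (y k) = ∑ a, p j a * ∑ b, p k b * h a b := by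
  classical
  have h1 : ∀ y : ι → A, (∏ i, p i (y i)) * h (y j) (y k) =
      ∑ a, ∏ i, (p i (y i) * ((if i = j then (if y i = a then 1 else 0) else 1) *
        (if i = k then h a (y i) else 1))) := by
    intro y
    simp_rw [Finset.prod_mul_distrib, Finset.prod_ite_eq']
    simp
  simp_rw [h1]
  rw [Finset.sum_comm]
  refine Finset.sum_congr rfl fun a _ => ?_
  rw [← Fintype.prod_sum (fun i b => p i b * ((if i = j then (if b = a then 1 else 0) else 1) *
        (if i = k then h a b else 1))), Fintype.prod_eq_mul j k hjk]
  · simp [hjk, hjk.symm]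
  · rintro i ⟨hi, hi'⟩
    simp [hi, hi', hp]

end Products

section Simplex

variable {A : Type*} [Fintype A]

theorem productDist_mem {q : A → ℝ} (hq : q ∈ stdSimplex ℝ A) (n : ℕ) :
    productDist q n ∈ stdSimplex ℝ (Fin n → A) :=
  ⟨fun _ => Finset.prod_nonneg fun _ _ => hq.1 _, sum_prod_eq_one fun _ => hq.2⟩

theorem blockChannel_mem {W : Fin 2 → A → ℝ} (hW : IsBinaryChannel W) {n : ℕ}
    (x : Fin n → Fin 2) : blockChannel W x ∈ stdSimplex ℝ (Fin n → A) :=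
  ⟨fun _ => Finset.prod_nonneg fun _ _ => (hW _).1 _, sum_prod_eq_one fun i => (hW (x i)).2⟩

theorem productDist_pos {q : A → ℝ} (hq : q ∈ stdSimplex ℝ A) {n : ℕ} {y : Fin n → A}
    (hy : productDist q n y ≠ 0) (i : Fin n) : 0 < q (y i) :=
  lt_of_le_of_ne (hq.1 _) fun h => hy (Finset.prod_eq_zero (Finset.mem_univ i) h.symm)

theorem le_one_of_mem {q : A → ℝ} (hq : q ∈ stdSimplex ℝ A) (a : A) : q a ≤ 1 :=
  hq.2 ▸ Finset.single_le_sum (f := q) (fun b _ => hq.1 b) (Finset.mem_univ a)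

theorem mean_apply {q : A → ℝ} (hq : q ∈ stdSimplex ℝ A) {L : ℕ} (l : Fin L) (g : A → ℝ) :
    ∑ c, productDist q L c * g (c l) = ∑ a, q a * g a :=
  sum_prod_mul_apply (fun _ => hq.2) l g

/-- The second moment of the average of `L` independent copies of `g`. -/
theorem second_moment_average_le {q : A → ℝ} (hq : q ∈ stdSimplex ℝ A) {L : ℕ} (hL : 0 < L)
    (g : A → ℝ) :
    ∑ c, productDist q L c * ((1 / (L : ℝ)) * ∑ l, g (c l)) ^ 2 ≤
      (∑ a, q a * g a ^ 2) / L + (∑ a, q a * g a) ^ 2 := by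
  set v := ∑ a, q a * g a ^ 2 with hv
  set μ := ∑ a, q a * g a with hμ
  have hv0 : 0 ≤ v := Finset.sum_nonneg fun a _ => mul_nonneg (hq.1 a) (sq_nonneg _)
  have h1 : ∀ l l' : Fin L, ∑ c, productDist q L c * (g (c l) * g (c l')) ≤
      (if l = l' then v else 0) + μ ^ 2 := by
    intro l l'
    split_ifs with h
    · subst h
      have := mean_apply hq l (fun a => g a ^ 2)
      simp only [pow_two] at this ⊢
      rw [this]
      simp only [hv, pow_two]
      nlinarith [mul_self_nonneg μ]
    · have := sum_prod_mul_apply₂ (p := fun _ : Fin L => q) (fun _ => hq.2) h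
        (fun a b => g a * g b)
      simp only [productDist]
      rw [this, zero_add, pow_two]
      conv_rhs => rw [hμ, Finset.sum_mul]
      refine le_of_eq (Finset.sum_congr rfl fun a _ => ?_)
      rw [mul_assoc, Finset.mul_sum Finset.univ _ (g a)]
      exact congrArg _ (Finset.sum_congr rfl fun b _ => by ring)
  have h2 : ∑ c, productDist q L c * ((1 / (L : ℝ)) * ∑ l, g (c l)) ^ 2 =
      (1 / (L : ℝ)) ^ 2 * ∑ l, ∑ l', ∑ c, productDist q L c * (g (c l) * g (c l')) := by
    have : ∀ c : Fin L → A, productDist q L c * ((1 / (L : ℝ)) * ∑ l, g (c l)) ^ 2 =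
        (1 / (L : ℝ)) ^ 2 * ∑ l, ∑ l', productDist q L c * (g (c l) * g (c l')) := by
      intro c
      simp_rw [← Finset.mul_sum]
      rw [← Finset.sum_mul]
      ring
    simp_rw [this]
    rw [← Finset.mul_sum, Finset.sum_comm]
    congr 1
    exact Finset.sum_congr rfl fun l _ => Finset.sum_comm
  have hL' : (0 : ℝ) < L := by exact_mod_cast hL
  have h3 : ∑ l : Fin L, ∑ l' : Fin L, ∑ c, productDist q L c * (g (c l) * g (c l')) ≤
      L * v + L ^ 2 * μ ^ 2 := by
    refine (Finset.sum_le_sum fun l _ => Finset.sum_le_sum fun l' _ => h1 l l').trans ?_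
    simp [Finset.sum_add_distrib]
    apply le_of_eq
    ring
  rw [h2]
  calc _ ≤ (1 / (L : ℝ)) ^ 2 * (L * v + L ^ 2 * μ ^ 2) := by gcongr
    _ = _ := by field_simp

theorem sum_productDist_mul_exp (q : A → ℝ) (L : ℕ) (g : A → ℝ) :
    ∑ c, productDist q L c * Real.exp (∑ l, g (c l)) = (∑ a, q a * Real.exp (g a)) ^ L := by
  rw [Fintype.sum_pow]
  refine Finset.sum_congr rfl fun c _ => ?_
  rw [productDist, Real.exp_sum, Finset.prod_mul_distrib]

/-- Chernoff's bound for independent `[0, 1]`-valued variables, as a bound on the exponential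
moment. -/
theorem exp_moment_le {q : A → ℝ} (hq : q ∈ stdSimplex ℝ A) (L : ℕ) {g : A → ℝ}
    (h0 : ∀ a, 0 ≤ g a) (h1 : ∀ a, g a ≤ 1) :
    ∑ c, productDist q L c * Real.exp (∑ l, g (c l)) ≤ Real.exp (L * (2 * ∑ a, q a * g a)) := by
  rw [sum_productDist_mul_exp, Real.exp_nat_mul]
  refine pow_le_pow_left₀
    (Finset.sum_nonneg fun a _ => mul_nonneg (hq.1 a) (Real.exp_nonneg _)) ?_ L
  have h2 : ∀ a, q a * Real.exp (g a) ≤ q a + 2 * (q a * g a) := by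
    intro a
    have := (abs_le.1 (Real.abs_exp_sub_one_sub_id_le (x := g a)
      (abs_le.2 ⟨by linarith [h0 a], h1 a⟩))).2
    nlinarith [hq.1 a, h0 a, h1 a, mul_nonneg (h0 a) (sub_nonneg.2 (h1 a))]
  calc _ ≤ ∑ a, (q a + 2 * (q a * g a)) := Finset.sum_le_sum fun a _ => h2 a
    _ = 1 + 2 * ∑ a, q a * g a := by rw [Finset.sum_add_distrib, ← Finset.mul_sum, hq.2]
    _ ≤ _ := by linarith [Real.add_one_le_exp (2 * ∑ a, q a * g a)]

/-- A random variable takes some value below any number above its mean. -/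
theorem exists_lt_of_mean_lt {q : A → ℝ} (hq : q ∈ stdSimplex ℝ A) {F : A → ℝ} {t : ℝ}
    (h : ∑ a, q a * F a < t) : ∃ a, F a < t := by
  have : ∑ a, q a * F a < ∑ a, q a * t := by rwa [← Finset.sum_mul, hq.2, one_mul]
  obtain ⟨a, -, ha⟩ := Finset.exists_lt_of_sum_lt this
  exact ⟨a, lt_of_mul_lt_mul_left ha (hq.1 a)⟩

/-! ### Masses of sets -/

theorem mass_nonneg {p : A → ℝ} (hp : ∀ a, 0 ≤ p a) (S : Set A) : 0 ≤ mass p S :=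
  Finset.sum_nonneg fun a _ => Set.indicator_nonneg (fun a _ => hp a) a

theorem mass_mono {p : A → ℝ} (hp : ∀ a, 0 ≤ p a) {S T : Set A} (h : S ⊆ T) :
    mass p S ≤ mass p T :=
  Finset.sum_le_sum fun a _ => Set.indicator_le_indicator_of_subset h hp a

theorem mass_compl_add {p : A → ℝ} (hp : p ∈ stdSimplex ℝ A) (S : Set A) :
    mass p Sᶜ + mass p S = 1 := by
  rw [mass, mass, ← Finset.sum_add_distrib, ← hp.2]
  exact Finset.sum_congr rfl fun a _ => Set.indicator_compl_add_self_apply S p a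

theorem mass_le_one {p : A → ℝ} (hp : p ∈ stdSimplex ℝ A) (S : Set A) : mass p S ≤ 1 := by
  linarith [mass_compl_add hp S, mass_nonneg hp.1 Sᶜ]

theorem sum_mul_mass {B : Type*} [Fintype B] (q : B → ℝ) (p : B → A → ℝ) (S : Set A) :
    ∑ b, q b * mass (p b) S = mass (fun a => ∑ b, q b * p b a) S := by
  simp_rw [mass, Finset.mul_sum]
  rw [Finset.sum_comm]
  refine Finset.sum_congr rfl fun a _ => ?_
  by_cases ha : a ∈ S <;> simp [ha]

/-- Comparison of two masses through the second moment of the likelihood ratio; `c` is a free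
parameter, whose best choice would give the Cauchy–Schwarz inequality. -/
theorem mass_le_of_second_moment {p q : A → ℝ} (hp : ∀ a, 0 ≤ p a) (hq : ∀ a, 0 ≤ q a)
    (hpq : AbsCont p q) {c : ℝ} (hc : 0 < c) (S : Set A) :
    mass p S ≤ c * mass q S + (∑ a, p a ^ 2 / q a) / c := by
  rw [mass, mass, Finset.mul_sum, Finset.sum_div, ← Finset.sum_add_distrib]
  refine Finset.sum_le_sum fun a _ => ?_
  by_cases ha : a ∈ S
  · simp only [ha, Set.indicator_of_mem]
    rcases (hq a).eq_or_lt with h | h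
    · simp [hpq a h.symm, ← h]
    · have h2 : 0 ≤ (c * q a - p a) ^ 2 / (c * q a) := by positivity
      have h3 : (c * q a - p a) ^ 2 / (c * q a) = c * q a + p a ^ 2 / q a / c - 2 * p a := by
        field_simp
        ring
      linarith [hp a]
  · simp only [ha, not_false_eq_true, Set.indicator_of_notMem, mul_zero, zero_add]
    have := hq a
    positivity

/-! ### Relative entropy -/

/-- The Donsker–Varadhan inequality. -/
theorem mean_le_klDivergence_add_log {P Q : A → ℝ} (hP : P ∈ stdSimplex ℝ A)
    (hQ : ∀ a, 0 ≤ Q a) (hPQ : AbsCont P Q) (f : A → ℝ) :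
    ∑ a, P a * f a ≤ klDivergence P Q + Real.log (∑ a, Q a * Real.exp (f a)) := by
  set Z := ∑ a, Q a * Real.exp (f a) with hZ
  have hterm : ∀ a, 0 ≤ Q a * Real.exp (f a) := fun a => mul_nonneg (hQ a) (Real.exp_nonneg _)
  have hZpos : 0 < Z := by
    refine lt_of_le_of_ne (Finset.sum_nonneg fun a _ => hterm a) fun h => ?_
    have h0 := (Finset.sum_eq_zero_iff_of_nonneg fun a _ => hterm a).1 h.symm
    have : ∑ a, P a = 0 := Finset.sum_eq_zero fun a ha => hPQ a <|
      (mul_eq_zero.1 (h0 a ha)).resolve_right (Real.exp_pos _).ne'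
    linarith [hP.2]
  have key : ∀ a, P a * f a ≤
      P a * Real.log (P a / Q a) + P a * Real.log Z + (Q a * Real.exp (f a) / Z - P a) := by
    intro a
    rcases (hP.1 a).eq_or_lt with h | h
    · simp only [← h, zero_mul, zero_add, sub_zero]
      exact div_nonneg (hterm a) hZpos.le
    · have hQa : 0 < Q a := lt_of_le_of_ne (hQ a) fun h' => h.ne' (hPQ a h'.symm)
      have h1 := Real.log_le_sub_one_of_pos (x := Q a * Real.exp (f a) / (P a * Z))
        (by positivity)
      rw [Real.log_div (by positivity) (by positivity), Real.log_mul hQa.ne' (Real.exp_pos _).ne',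
        Real.log_mul h.ne' hZpos.ne', Real.log_exp] at h1
      rw [Real.log_div h.ne' hQa.ne']
      have h2 : P a * (Q a * Real.exp (f a) / (P a * Z) - 1) =
          Q a * Real.exp (f a) / Z - P a := by
        field_simp
      nlinarith [mul_le_mul_of_nonneg_left h1 h.le]
  calc _ ≤ ∑ a, (P a * Real.log (P a / Q a) + P a * Real.log Z +
        (Q a * Real.exp (f a) / Z - P a)) := Finset.sum_le_sum fun a _ => key a
    _ = _ := by
      rw [Finset.sum_add_distrib, Finset.sum_add_distrib, Finset.sum_sub_distrib,
        ← Finset.sum_mul, ← Finset.sum_div, ← hZ, hP.2, div_self hZpos.ne', klDivergence]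
      ring

theorem klDivergence_nonneg {P Q : A → ℝ} (hP : P ∈ stdSimplex ℝ A) (hQ : Q ∈ stdSimplex ℝ A)
    (hPQ : AbsCont P Q) : 0 ≤ klDivergence P Q := by
  simpa [hQ.2] using mean_le_klDivergence_add_log hP hQ.1 hPQ (fun _ => 0)

/-- Relative entropy with respect to `Q`, estimated through an intermediate distribution `R`: the
price is a `χ₂`-distance to `R` and the rest is linear in `P`. -/
theorem klDivergence_le_of_intermediate {P R Q : A → ℝ} (hP : P ∈ stdSimplex ℝ A)
    (hR : ∀ a, 0 ≤ R a) (hPR : AbsCont P R) (hRQ : AbsCont R Q) :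
    klDivergence P Q ≤ ∑ a, P a ^ 2 / R a - 1 + ∑ a, P a * Real.log (R a / Q a) := by
  have key : ∀ a, P a * Real.log (P a / Q a) ≤
      P a ^ 2 / R a - P a + P a * Real.log (R a / Q a) := by
    intro a
    rcases (hP.1 a).eq_or_lt with h | h
    · simp [← h]
    · have hRa : 0 < R a := lt_of_le_of_ne (hR a) fun h' => h.ne' (hPR a h'.symm)
      have hQa : Q a ≠ 0 := fun h' => hRa.ne' (hRQ a h')
      have h1 := Real.log_le_sub_one_of_pos (x := P a / R a) (by positivity)
      rw [Real.log_div h.ne' hRa.ne'] at h1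
      rw [Real.log_div h.ne' hQa, Real.log_div hRa.ne' hQa]
      have h2 : P a * (P a / R a - 1) = P a ^ 2 / R a - P a := by ring
      nlinarith [mul_le_mul_of_nonneg_left h1 h.le]
  calc _ ≤ ∑ a, (P a ^ 2 / R a - P a + P a * Real.log (R a / Q a)) :=
        Finset.sum_le_sum fun a _ => key a
    _ = _ := by rw [Finset.sum_add_distrib, Finset.sum_sub_distrib, hP.2]

/-- Relative entropy is additive over product distributions. -/
theorem klDivergence_productDist {P Q : A → ℝ} (hP : P ∈ stdSimplex ℝ A) (hPQ : AbsCont P Q)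
    (n : ℕ) : klDivergence (productDist P n) (productDist Q n) = n * klDivergence P Q := by
  have h1 : ∀ y : Fin n → A,
      productDist P n y * Real.log (productDist P n y / productDist Q n y) =
      ∑ i, productDist P n y * Real.log (P (y i) / Q (y i)) := by
    intro y
    by_cases hy : productDist P n y = 0
    · simp [hy]
    · have hpos := productDist_pos hP hy
      rw [← Finset.mul_sum, ← Real.log_prod, Finset.prod_div_distrib]
      · rfl
      · exact fun i _ => div_ne_zero (hpos i).ne' fun h => (hpos i).ne' (hPQ _ h)
  rw [klDivergence]
  simp_rw [h1]
  rw [Finset.sum_comm]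
  simp_rw [mean_apply hP _ (fun a => Real.log (P a / Q a))]
  simp [klDivergence]

end Simplex

/-! ### Expansions near the innocent distribution -/

section Expansions

variable {A : Type*} [Fintype A]

/-- Third-order expansion at `0` of the moment generating function of a function on a finite
set. -/
theorem exists_exp_moment_expansion {p : A → ℝ} (hp : ∀ a, 0 ≤ p a) (g : A → ℝ) :
    ∃ C : ℝ, 0 ≤ C ∧ ∃ s₀ : ℝ, 0 < s₀ ∧ ∀ s : ℝ, |s| ≤ s₀ →
      ∑ a, p a * Real.exp (s * g a) ≤
        ∑ a, p a + s * ∑ a, p a * g a + s ^ 2 / 2 * ∑ a, p a * g a ^ 2 + C * |s| ^ 3 := by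
  have hG : 0 ≤ ∑ a, |g a| := Finset.sum_nonneg fun _ _ => abs_nonneg _
  refine ⟨∑ a, p a * |g a| ^ 3,
    Finset.sum_nonneg fun a _ => mul_nonneg (hp a) (by positivity),
    1 / (1 + ∑ a, |g a|), by positivity, fun s hs => ?_⟩
  have key : ∀ a, p a * Real.exp (s * g a) ≤ p a + s * (p a * g a) +
      s ^ 2 / 2 * (p a * g a ^ 2) + (p a * |g a| ^ 3) * |s| ^ 3 := by
    intro a
    have hga : |g a| ≤ ∑ a, |g a| :=
      Finset.single_le_sum (f := fun a => |g a|) (fun _ _ => abs_nonneg _) (Finset.mem_univ a)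
    have h1 : |s * g a| ≤ 1 := by
      rw [abs_mul]
      calc |s| * |g a| ≤ 1 / (1 + ∑ a, |g a|) * (1 + ∑ a, |g a|) := by
            gcongr
            linarith
        _ = 1 := by field_simp
    have h2 := (abs_le.1 (Real.exp_bound h1 (n := 3) (by norm_num))).2
    simp only [Finset.sum_range_succ, Finset.sum_range_zero, Nat.factorial, abs_mul, mul_pow,
      pow_zero, pow_one, Nat.cast_one, Nat.succ_eq_add_one] at h2
    norm_num at h2
    have h3 : 0 ≤ |s| ^ 3 * |g a| ^ 3 := by positivity
    have h4 : Real.exp (s * g a) ≤ 1 + s * g a + s ^ 2 * g a ^ 2 / 2 + |s| ^ 3 * |g a| ^ 3 := by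
      linarith
    nlinarith [mul_le_mul_of_nonneg_left h4 (hp a)]
  calc _ ≤ ∑ a, (p a + s * (p a * g a) +
      s ^ 2 / 2 * (p a * g a ^ 2) + (p a * |g a| ^ 3) * |s| ^ 3) :=
        Finset.sum_le_sum fun a _ => key a
    _ = _ := by
      simp only [Finset.sum_add_distrib, ← Finset.mul_sum, ← Finset.sum_mul]

theorem one_add_mul_log_le {v : ℝ} (hv : |v| ≤ 1 / 2) :
    (1 + v) * Real.log (1 + v) ≤ v + v ^ 2 / 2 + 4 * |v| ^ 3 := by
  have h1 := Real.abs_log_sub_add_sum_range_le (x := -v) (by rw [abs_neg]; linarith) 2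
  simp only [Finset.sum_range_succ, Finset.sum_range_zero, abs_neg, sub_neg_eq_add] at h1
  norm_num at h1
  have h2 : |v| ^ 3 / (1 - |v|) ≤ 2 * |v| ^ 3 := by
    rw [div_le_iff₀ (by linarith)]
    nlinarith [show 0 ≤ |v| ^ 3 by positivity]
  have h3 : Real.log (1 + v) ≤ v - v ^ 2 / 2 + 2 * |v| ^ 3 := by
    linarith [(abs_le.1 h1).2]
  have hv' := abs_le.1 hv
  have h5 : -v ^ 3 ≤ |v| ^ 3 := by
    rw [← abs_pow]
    exact neg_le_abs _
  have h6 : 0 ≤ |v| ^ 3 := by positivity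
  nlinarith [mul_le_mul_of_nonneg_left h3 (show 0 ≤ 1 + v by linarith),
    mul_nonneg (show 0 ≤ |v| ^ 3 by positivity) (show 0 ≤ 1 / 2 - v by linarith)]

/-- The density `P₁ / P₀ - 1` of the signed measure `P₁ - P₀` with respect to `P₀`, for the two
output distributions `P₀`, `P₁` of a binary-input channel. -/
noncomputable def score (V : Fin 2 → A → ℝ) (a : A) : ℝ :=
  (V 1 a - V 0 a) / V 0 a

/-- The output distribution of one use of the channel `W` whose input is `1` with probability
`α`. -/
noncomputable def mixOutput (W : Fin 2 → A → ℝ) (α : ℝ) (a : A) : ℝ :=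
  (1 - α) * W 0 a + α * W 1 a

variable {V : Fin 2 → A → ℝ}

theorem mul_score {A : Type*} {V : Fin 2 → A → ℝ} (hac : AbsCont (V 1) (V 0)) (a : A) :
    V 0 a * score V a = V 1 a - V 0 a := by
  by_cases h : V 0 a = 0
  · simp [h, hac a h]
  · rw [score]
    field_simp

theorem sum_mul_score (hV : IsBinaryChannel V) (hac : AbsCont (V 1) (V 0)) :
    ∑ a, V 0 a * score V a = 0 := by
  simp_rw [mul_score hac]
  rw [Finset.sum_sub_distrib, (hV 1).2, (hV 0).2, sub_self]

theorem sum_mul_score_sq (hac : AbsCont (V 1) (V 0)) :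
    ∑ a, V 0 a * score V a ^ 2 = chiSquare (V 1) (V 0) := by
  refine Finset.sum_congr rfl fun a => ?_
  rw [pow_two, ← mul_assoc, mul_score hac, score]
  intro _
  ring

theorem sum_one_mul_score (hV : IsBinaryChannel V) (hac : AbsCont (V 1) (V 0)) :
    ∑ a, V 1 a * score V a = chiSquare (V 1) (V 0) := by
  rw [← sum_mul_score_sq hac, ← add_zero (∑ a, V 0 a * score V a ^ 2), ← sum_mul_score hV hac,
    ← Finset.sum_add_distrib]
  refine Finset.sum_congr rfl fun a _ => ?_
  linear_combination -score V a * mul_score hac a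

theorem chiSquare_nonneg (hV : IsBinaryChannel V) : 0 ≤ chiSquare (V 1) (V 0) :=
  Finset.sum_nonneg fun a _ => div_nonneg (sq_nonneg _) ((hV 0).1 a)

theorem chiSquare_pos (hV : IsBinaryChannel V) (hac : AbsCont (V 1) (V 0)) (hne : V 1 ≠ V 0) :
    0 < chiSquare (V 1) (V 0) := by
  refine lt_of_le_of_ne (chiSquare_nonneg hV) fun h => hne (funext fun a => ?_)
  have h0 := (Finset.sum_eq_zero_iff_of_nonneg
    fun a _ => div_nonneg (sq_nonneg (V 1 a - V 0 a)) ((hV 0).1 a)).1 h.symm a (Finset.mem_univ a)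
  rcases div_eq_zero_iff.1 h0 with h1 | h1
  · exact sub_eq_zero.1 (pow_eq_zero_iff two_ne_zero |>.1 h1)
  · rw [hac a h1, h1]

theorem mixOutput_eq {A : Type*} {V : Fin 2 → A → ℝ} (hac : AbsCont (V 1) (V 0)) (α : ℝ) (a : A) :
    mixOutput V α a = V 0 a * (1 + α * score V a) := by
  rw [mixOutput, mul_add, mul_left_comm, mul_score hac]
  ring

theorem mixOutput_mem (hV : IsBinaryChannel V) {α : ℝ} (h0 : 0 ≤ α) (h1 : α ≤ 1) :
    mixOutput V α ∈ stdSimplex ℝ A := by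
  refine ⟨fun a => ?_, ?_⟩
  · have := (hV 0).1 a
    have := (hV 1).1 a
    have := sub_nonneg.2 h1
    rw [mixOutput]
    positivity
  · simp only [mixOutput, Finset.sum_add_distrib, ← Finset.mul_sum, (hV _).2]
    ring

theorem mixOutput_absCont {A : Type*} {V : Fin 2 → A → ℝ} (hac : AbsCont (V 1) (V 0)) (α : ℝ) :
    AbsCont (mixOutput V α) (V 0) := fun a ha => by
  rw [mixOutput_eq hac, ha, zero_mul]

theorem absCont_productDist {A : Type*} {P Q : A → ℝ} (h : AbsCont P Q) (n : ℕ) :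
    AbsCont (productDist P n) (productDist Q n) := fun y hy => by
  obtain ⟨i, -, hi⟩ := Finset.prod_eq_zero_iff.1 hy
  exact Finset.prod_eq_zero (Finset.mem_univ i) (h _ hi)

/-- No input word reaches an output word that has probability zero under a mixture in which the
innocent symbol has positive weight. -/
theorem blockChannel_eq_zero (hV : IsBinaryChannel V) {α : ℝ} (h0 : 0 ≤ α) (h1 : α < 1)
    (hac : AbsCont (V 1) (V 0)) {n : ℕ} (x : Fin n → Fin 2) {z : Fin n → A}
    (hz : productDist (mixOutput V α) n z = 0) : blockChannel V x z = 0 := by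
  obtain ⟨i, -, hi⟩ := Finset.prod_eq_zero_iff.1 hz
  refine Finset.prod_eq_zero (Finset.mem_univ i) ?_
  have ha := (hV 0).1 (z i)
  have hb := (hV 1).1 (z i)
  have h2 := mul_nonneg (sub_nonneg.2 h1.le) ha
  have h3 := mul_nonneg h0 hb
  have h4 : V 0 (z i) = 0 := by
    rw [mixOutput] at hi
    exact (mul_eq_zero.1 (by linarith)).resolve_left (sub_pos.2 h1).ne'
  by_cases hx : x i = 0
  · rw [hx, h4]
  · rw [Fin.eq_one_of_ne_zero _ hx, hac _ h4]

/-- Second-order expansion of the relative entropy between a small perturbation of the innocent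
output distribution and that distribution. -/
theorem exists_klDivergence_mixOutput_le (hV : IsBinaryChannel V) (hac : AbsCont (V 1) (V 0)) :
    ∃ C : ℝ, 0 ≤ C ∧ ∃ α₀ : ℝ, 0 < α₀ ∧ ∀ α : ℝ, 0 ≤ α → α ≤ α₀ →
      klDivergence (mixOutput V α) (V 0) ≤ α ^ 2 / 2 * chiSquare (V 1) (V 0) + C * α ^ 3 := by
  have hG : 0 ≤ ∑ a, |score V a| := Finset.sum_nonneg fun _ _ => abs_nonneg _
  refine ⟨∑ a, V 0 a * (4 * |score V a| ^ 3),
    Finset.sum_nonneg fun a _ => mul_nonneg ((hV 0).1 a) (by positivity),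
    1 / (2 * (1 + ∑ a, |score V a|)), by positivity, fun α h0 h1 => ?_⟩
  have key : ∀ a, mixOutput V α a * Real.log (mixOutput V α a / V 0 a) ≤
      α * (V 0 a * score V a) + α ^ 2 / 2 * (V 0 a * score V a ^ 2) +
        (V 0 a * (4 * |score V a| ^ 3)) * α ^ 3 := by
    intro a
    rcases ((hV 0).1 a).eq_or_lt with h | h
    · simp [mixOutput_eq hac, ← h]
    · have hga : |score V a| ≤ ∑ a, |score V a| :=
        Finset.single_le_sum (f := fun a => |score V a|) (fun _ _ => abs_nonneg _)
          (Finset.mem_univ a)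
      have h2 : |α * score V a| ≤ 1 / 2 := by
        rw [abs_mul, abs_of_nonneg h0]
        calc α * |score V a| ≤ 1 / (2 * (1 + ∑ a, |score V a|)) * (1 + ∑ a, |score V a|) := by
              gcongr
              linarith
          _ = 1 / 2 := by field_simp
      have h3 := one_add_mul_log_le h2
      rw [abs_mul, abs_of_nonneg h0] at h3
      rw [mixOutput_eq hac, mul_div_cancel_left₀ _ h.ne', mul_assoc]
      refine (mul_le_mul_of_nonneg_left h3 h.le).trans (le_of_eq ?_)
      ring
  calc _ ≤ ∑ a, (α * (V 0 a * score V a) + α ^ 2 / 2 * (V 0 a * score V a ^ 2) +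
        (V 0 a * (4 * |score V a| ^ 3)) * α ^ 3) := Finset.sum_le_sum fun a _ => key a
    _ = _ := by
      rw [Finset.sum_add_distrib, Finset.sum_add_distrib, ← Finset.mul_sum, ← Finset.mul_sum,
        ← Finset.sum_mul, sum_mul_score hV hac, sum_mul_score_sq hac]
      ring

/-- The second moment of the likelihood ratio of a mixture is bounded for a number of channel uses
of order `α⁻²`. -/
theorem second_moment_mixOutput_le (hV : IsBinaryChannel V) (hac : AbsCont (V 1) (V 0))
    (α : ℝ) (n : ℕ) :
    ∑ y, productDist (mixOutput V α) n y ^ 2 / productDist (V 0) n y ≤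
      Real.exp (n * (α ^ 2 * chiSquare (V 1) (V 0))) := by
  have h1 : ∀ a, mixOutput V α a ^ 2 / V 0 a =
      V 0 a + 2 * α * (V 0 a * score V a) + α ^ 2 * (V 0 a * score V a ^ 2) := by
    intro a
    rw [mixOutput_eq hac]
    by_cases h : V 0 a = 0
    · simp [h]
    · field_simp
      ring
  have h2 : ∑ a, mixOutput V α a ^ 2 / V 0 a = 1 + α ^ 2 * chiSquare (V 1) (V 0) := by
    simp_rw [h1]
    rw [Finset.sum_add_distrib, Finset.sum_add_distrib, ← Finset.mul_sum, ← Finset.mul_sum,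
      sum_mul_score hV hac, sum_mul_score_sq hac, (hV 0).2]
    ring
  have h3 : ∑ y, productDist (mixOutput V α) n y ^ 2 / productDist (V 0) n y =
      (∑ a, mixOutput V α a ^ 2 / V 0 a) ^ n := by
    rw [Fintype.sum_pow]
    refine Finset.sum_congr rfl fun y _ => ?_
    rw [productDist, productDist, ← Finset.prod_pow, Finset.prod_div_distrib]
  rw [h3, h2, Real.exp_nat_mul]
  have := chiSquare_nonneg hV
  refine pow_le_pow_left₀ (by positivity) ?_ n
  linarith [Real.add_one_le_exp (α ^ 2 * chiSquare (V 1) (V 0))]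

end Expansions

/-! ### Random inputs and the information density -/

section Information

variable {A : Type*} [Fintype A] {W : Fin 2 → A → ℝ} {n : ℕ}

/-- The distribution of an input symbol that is `1` with probability `α`. -/
noncomputable def bernoulli (α : ℝ) : Fin 2 → ℝ :=
  ![1 - α, α]

theorem bernoulli_mem {α : ℝ} (h0 : 0 ≤ α) (h1 : α ≤ 1) :
    bernoulli α ∈ stdSimplex ℝ (Fin 2) := by
  refine ⟨fun i => ?_, by simp [bernoulli]⟩
  fin_cases i
  · simpa [bernoulli] using h1
  · simpa [bernoulli] using h0

theorem sum_bernoulli_blockChannel {A : Type*} (W : Fin 2 → A → ℝ) (α : ℝ) (y : Fin n → A) :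
    ∑ x, productDist (bernoulli α) n x * blockChannel W x y =
      productDist (mixOutput W α) n y := by
  simp_rw [productDist, blockChannel, ← Finset.prod_mul_distrib]
  rw [← Fintype.prod_sum (fun i c => bernoulli α c * W c (y i))]
  simp [bernoulli, mixOutput]

/-- The number of non-innocent symbols of a word. -/
def weight (x : Fin n → Fin 2) : ℕ :=
  ∑ i, if x i = 1 then 1 else 0

/-- The logarithm of the likelihood ratio between the input `x` and the innocent input. -/
noncomputable def infoDensity (W : Fin 2 → A → ℝ) (x : Fin n → Fin 2) (y : Fin n → A) : ℝ :=
  ∑ i, if x i = 1 then Real.log (W 1 (y i) / W 0 (y i)) else 0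

theorem blockChannel_eq_exp_infoDensity (hW : IsBinaryChannel W) (hac : AbsCont (W 1) (W 0))
    {x : Fin n → Fin 2} {y : Fin n → A} (h : blockChannel W x y ≠ 0) :
    blockChannel W x y = Real.exp (infoDensity W x y) * productDist (W 0) n y := by
  rw [infoDensity, Real.exp_sum, productDist, ← Finset.prod_mul_distrib, blockChannel]
  refine Finset.prod_congr rfl fun i _ => ?_
  have hi : W (x i) (y i) ≠ 0 := fun h' => h (Finset.prod_eq_zero (Finset.mem_univ i) h')
  by_cases hx : x i = 1
  · rw [hx] at hi ⊢
    have h1 := lt_of_le_of_ne ((hW 1).1 (y i)) hi.symm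
    have h0 := lt_of_le_of_ne ((hW 0).1 (y i)) fun h' => hi (hac _ h'.symm)
    rw [if_pos rfl, Real.exp_log (by positivity)]
    field_simp
  · have : x i = 0 := by
      by_contra h'
      exact hx (Fin.eq_one_of_ne_zero _ h')
    simp [this]

/-- Chernoff's bound for the tails of the information density: the upper tail for `0 ≤ s` and the
lower tail for `s ≤ 0`. -/
theorem mass_tail_le (hW : IsBinaryChannel W) (s γ : ℝ) (x : Fin n → Fin 2)
    {S : Set (Fin n → A)} (hS : ∀ y ∈ S, blockChannel W x y ≠ 0 → s * γ ≤ s * infoDensity W x y) :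
    mass (blockChannel W x) S ≤ Real.exp (-(s * γ)) *
      (∑ a, W 1 a * Real.exp (s * Real.log (W 1 a / W 0 a))) ^ weight x := by
  have h1 : ∀ y, S.indicator (blockChannel W x) y ≤
      Real.exp (-(s * γ)) * (blockChannel W x y * Real.exp (s * infoDensity W x y)) := by
    intro y
    have h0 := (blockChannel_mem hW x).1 y
    by_cases hy : y ∈ S
    · rw [Set.indicator_of_mem hy]
      by_cases hz : blockChannel W x y = 0
      · simp [hz]
      · have : 1 ≤ Real.exp (-(s * γ)) * Real.exp (s * infoDensity W x y) := by
          rw [← Real.exp_add]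
          exact Real.one_le_exp (by linarith [hS y hy hz])
        nlinarith
    · rw [Set.indicator_of_notMem hy]
      positivity
  refine (Finset.sum_le_sum fun y _ => h1 y).trans (le_of_eq ?_)
  rw [← Finset.mul_sum]
  congr 1
  have h2 : ∀ y : Fin n → A, blockChannel W x y * Real.exp (s * infoDensity W x y) =
      ∏ i, (W (x i) (y i) * if x i = 1 then
        Real.exp (s * Real.log (W 1 (y i) / W 0 (y i))) else 1) := by
    intro y
    rw [infoDensity, Finset.mul_sum, Real.exp_sum, blockChannel, ← Finset.prod_mul_distrib]
    refine Finset.prod_congr rfl fun i _ => ?_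
    split_ifs <;> simp
  simp_rw [h2]
  rw [← Fintype.prod_sum (fun i a => W (x i) a * if x i = 1 then
        Real.exp (s * Real.log (W 1 a / W 0 a)) else 1), weight, ← Finset.prod_pow_eq_pow_sum]
  refine Finset.prod_congr rfl fun i _ => ?_
  by_cases hx : x i = 1
  · simp [hx]
  · simp [hx, (hW _).2]

/-- The mean over random inputs of the generating function of the weight. -/
theorem sum_bernoulli_pow_weight_le {α : ℝ} (h0 : 0 ≤ α) (h1 : α ≤ 1) {m : ℝ} (hm : 0 ≤ m) :
    ∑ x : Fin n → Fin 2, productDist (bernoulli α) n x * m ^ weight x ≤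
      Real.exp (n * (α * (m - 1))) := by
  have h2 : ∀ x : Fin n → Fin 2, productDist (bernoulli α) n x * m ^ weight x =
      ∏ i, (bernoulli α (x i) * m ^ (if x i = 1 then 1 else 0)) := by
    intro x
    rw [weight, ← Finset.prod_pow_eq_pow_sum, productDist, ← Finset.prod_mul_distrib]
  simp_rw [h2]
  rw [← Fintype.sum_pow (fun c : Fin 2 => bernoulli α c * m ^ (if c = 1 then 1 else 0)),
    Real.exp_nat_mul]
  simp only [Fin.sum_univ_two, bernoulli]
  norm_num
  refine pow_le_pow_left₀ (by have := sub_nonneg.2 h1; positivity) ?_ n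
  linarith [Real.add_one_le_exp (α * (m - 1))]

end Information

/-! ### Random identification codes -/

section RandomCode

variable {Y : Type*} {n : ℕ}

/-- The identification code whose `m`-th message is encoded by a uniformly chosen entry of the list
`ω m` of input words, and whose `m`-th region is `D (ω m)`. -/
noncomputable def listCode {M L : ℕ} (hM : 0 < M) (hL : 0 < L)
    (D : (Fin L → Fin n → Fin 2) → Set (Fin n → Y)) (ω : Fin M → Fin L → Fin n → Fin 2) :
    IdCode Y n where
  size := M
  size_pos := hM
  codeword m x := ∑ l, if ω m l = x then 1 / (L : ℝ) else 0
  codeword_mem m := by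
    refine ⟨fun x => Finset.sum_nonneg fun l _ => by positivity, ?_⟩
    rw [Finset.sum_comm]
    have : (L : ℝ) ≠ 0 := by exact_mod_cast hL.ne'
    simp [this]
  region m := D (ω m)

theorem sum_listCode_codeword_mul {M L : ℕ} (hM : 0 < M) (hL : 0 < L)
    (D : (Fin L → Fin n → Fin 2) → Set (Fin n → Y)) (ω : Fin M → Fin L → Fin n → Fin 2)
    (m : Fin M) (g : (Fin n → Fin 2) → ℝ) :
    ∑ x, (listCode hM hL D ω).codeword m x * g x = (1 / (L : ℝ)) * ∑ l, g (ω m l) := by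
  simp only [listCode, Finset.sum_mul]
  rw [Finset.sum_comm, Finset.mul_sum]
  refine Finset.sum_congr rfl fun l _ => ?_
  simp

/-- The demapping region of a list of input words: the output words whose likelihood ratio with
respect to the innocent input exceeds `exp γ` for some word of the list. -/
def thresholdRegion (W : Fin 2 → Y → ℝ) (γ : ℝ) {L : ℕ} (c : Fin L → Fin n → Fin 2) :
    Set (Fin n → Y) :=
  {y | ∃ l, Real.exp γ * productDist (W 0) n y < blockChannel W (c l) y}

theorem mass_thresholdRegion_le [Fintype Y] {W : Fin 2 → Y → ℝ} (hW : IsBinaryChannel W) (γ : ℝ)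
    {L : ℕ} (c : Fin L → Fin n → Fin 2) :
    mass (productDist (W 0) n) (thresholdRegion W γ c) ≤ L * Real.exp (-γ) := by
  have h1 : ∀ y, (thresholdRegion W γ c).indicator (productDist (W 0) n) y ≤
      ∑ l, Real.exp (-γ) * blockChannel W (c l) y := by
    intro y
    have h0 : ∀ l, 0 ≤ Real.exp (-γ) * blockChannel W (c l) y :=
      fun l => mul_nonneg (Real.exp_nonneg _) ((blockChannel_mem hW _).1 y)
    by_cases hy : y ∈ thresholdRegion W γ c
    · rw [Set.indicator_of_mem hy]
      obtain ⟨l, hl⟩ := hy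
      refine le_trans ?_ (Finset.single_le_sum (fun l _ => h0 l) (Finset.mem_univ l))
      rw [Real.exp_neg, le_inv_mul_iff₀ (Real.exp_pos γ)]
      exact hl.le
    · rw [Set.indicator_of_notMem hy]
      exact Finset.sum_nonneg fun l _ => h0 l
  refine (Finset.sum_le_sum fun y _ => h1 y).trans (le_of_eq ?_)
  rw [Finset.sum_comm]
  simp [← Finset.mul_sum, (blockChannel_mem hW _).2]

/-- The empirical mean of `M` independent random distributions has, on average, hardly more relative
entropy than their mean `R`. -/
theorem mean_klDivergence_average_le {B C : Type*} [Fintype B] [Fintype C] {q : B → ℝ}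
    (hq : q ∈ stdSimplex ℝ B) {v : B → C → ℝ} (hv : ∀ b, v b ∈ stdSimplex ℝ C) {R Q : C → ℝ}
    (hR : ∀ z, ∑ b, q b * v b z = R z) (hvR : ∀ b, AbsCont (v b) R) (hRQ : AbsCont R Q)
    {M : ℕ} (hM : 0 < M) :
    ∑ ω, productDist q M ω * klDivergence (fun z => (1 / (M : ℝ)) * ∑ m, v (ω m) z) Q ≤
      Fintype.card C / M + klDivergence R Q := by
  have hM' : (0 : ℝ) < M := by exact_mod_cast hM
  have hR0 : ∀ z, 0 ≤ R z := fun z =>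
    hR z ▸ Finset.sum_nonneg fun b _ => mul_nonneg (hq.1 b) ((hv b).1 z)
  have hR1 : ∑ z, R z = 1 := by
    simp_rw [← hR]
    rw [Finset.sum_comm]
    simp [← Finset.mul_sum, (hv _).2, hq.2]
  set T : (Fin M → B) → C → ℝ := fun ω z => (1 / (M : ℝ)) * ∑ m, v (ω m) z with hT
  have hTmem : ∀ ω, T ω ∈ stdSimplex ℝ C := by
    refine fun ω => ⟨fun z => mul_nonneg (by positivity)
      (Finset.sum_nonneg fun m _ => (hv _).1 z), ?_⟩
    rw [← Finset.mul_sum, Finset.sum_comm]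
    simp [(hv _).2, hM'.ne']
  have hTR : ∀ ω, AbsCont (T ω) R := fun ω z hz => by
    simp [hT, hvR _ z hz]
  have hmean : ∀ z, ∑ ω, productDist q M ω * T ω z = R z := by
    intro z
    have : ∀ ω, productDist q M ω * T ω z = (1 / (M : ℝ)) * ∑ m, productDist q M ω * v (ω m) z := by
      intro ω
      rw [hT, ← Finset.mul_sum]
      ring
    simp_rw [this]
    rw [← Finset.mul_sum, Finset.sum_comm]
    simp_rw [mean_apply hq _ (fun b => v b z), hR]
    simp [hM'.ne']
  have hsq : ∀ z, ∑ ω, productDist q M ω * (T ω z ^ 2 / R z) ≤ 1 / M + R z := by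
    intro z
    have h1 : ∑ ω, productDist q M ω * T ω z ^ 2 ≤ R z / M + R z ^ 2 := by
      refine (second_moment_average_le hq hM (fun b => v b z)).trans ?_
      rw [hR]
      gcongr
      rw [← hR]
      refine Finset.sum_le_sum fun b _ => mul_le_mul_of_nonneg_left ?_ (hq.1 b)
      nlinarith [(hv b).1 z, le_one_of_mem (hv b) z]
    simp_rw [← mul_div_assoc]
    rw [← Finset.sum_div]
    rcases (hR0 z).eq_or_lt with h | h
    · rw [← h, div_zero, add_zero]
      positivity
    · rw [div_le_iff₀ h]
      refine h1.trans (le_of_eq ?_)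
      ring
  calc _ ≤ ∑ ω, productDist q M ω *
          (∑ z, T ω z ^ 2 / R z - 1 + ∑ z, T ω z * Real.log (R z / Q z)) :=
        Finset.sum_le_sum fun ω _ => mul_le_mul_of_nonneg_left
          (klDivergence_le_of_intermediate (hTmem ω) hR0 (hTR ω) hRQ) ((productDist_mem hq M).1 ω)
    _ = ∑ z, ∑ ω, productDist q M ω * (T ω z ^ 2 / R z) - 1 +
          ∑ z, (∑ ω, productDist q M ω * T ω z) * Real.log (R z / Q z) := by
      simp_rw [mul_add, mul_sub, Finset.sum_add_distrib, Finset.sum_sub_distrib, Finset.mul_sum,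
        Finset.sum_mul]
      rw [Finset.sum_comm]
      simp only [mul_one, (productDist_mem hq M).2]
      congr 1
      rw [Finset.sum_comm]
      simp_rw [mul_assoc]
    _ ≤ ∑ z : C, (1 / (M : ℝ) + R z) - 1 + klDivergence R Q := by
      simp_rw [hmean]
      have := Finset.sum_le_sum fun z (_ : z ∈ Finset.univ) => hsq z
      simp only [klDivergence]
      linarith
    _ = _ := by
      rw [Finset.sum_add_distrib, hR1]
      simp
      ring

/-- The random coding bound at a fixed blocklength. The lists `ω m` are independent, and so are
their entries, which are drawn symbol by symbol, `1` having probability `α`. The hypothesis `hsum`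
says that the mean number of defects of the random code is less than one; in it, `φ` bounds the
probability that a sent word misses the threshold, and `π` the mass of the demapping regions under
the mean output distribution. -/
theorem exists_idCode [Fintype Y] {Z : Type*} [Fintype Z] {W : Fin 2 → Y → ℝ} {V : Fin 2 → Z → ℝ}
    (hW : IsBinaryChannel W) (hV : IsBinaryChannel V) (hVac : AbsCont (V 1) (V 0))
    {α : ℝ} (hα0 : 0 ≤ α) (hα1 : α < 1) {δ : ℝ} (hδ : 0 < δ) {M L : ℕ} (hM : 0 < M) (hL : 0 < L)
    {γ lam φ π : ℝ}
    (hφ : ∑ x : Fin n → Fin 2, productDist (bernoulli α) n x * mass (blockChannel W x)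
      {y | blockChannel W x y ≤ Real.exp γ * productDist (W 0) n y} ≤ φ)
    (hπ : ∀ S : Set (Fin n → Y), mass (productDist (W 0) n) S ≤ L * Real.exp (-γ) →
      mass (productDist (mixOutput W α) n) S ≤ π)
    (hsum : ((Fintype.card Z : ℝ) ^ n / M + n * klDivergence (mixOutput V α) (V 0)) / δ +
      M * Real.exp (L * (2 * φ - lam)) + M ^ 2 * Real.exp (L * (2 * π - lam)) < 1) :
    ∃ C : IdCode Y n, C.size = M ∧ C.IsCovert V δ ∧ (∀ m, C.err1 W m ≤ lam) ∧
      (∀ m m', m ≠ m' → C.err2 W m m' ≤ lam) ∧ ∀ m, C.err3 W m ≤ L * Real.exp (-γ) := by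
  have hL' : (0 : ℝ) < L := by exact_mod_cast hL
  set p : (Fin n → Fin 2) → ℝ := productDist (bernoulli α) n with hp
  have hpm : p ∈ stdSimplex ℝ (Fin n → Fin 2) := productDist_mem (bernoulli_mem hα0 hα1.le) n
  set q : (Fin L → Fin n → Fin 2) → ℝ := productDist p L with hq
  have hqm : q ∈ stdSimplex ℝ (Fin L → Fin n → Fin 2) := productDist_mem hpm L
  set f : (Fin n → Fin 2) → ℝ := fun x => mass (blockChannel W x)
      {y | blockChannel W x y ≤ Real.exp γ * productDist (W 0) n y} with hf
  set D : (Fin L → Fin n → Fin 2) → Set (Fin n → Y) := thresholdRegion W γ with hD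
  set v : (Fin L → Fin n → Fin 2) → (Fin n → Z) → ℝ :=
    fun c z => (1 / (L : ℝ)) * ∑ l, blockChannel V (c l) z with hv
  have hvm : ∀ c, v c ∈ stdSimplex ℝ (Fin n → Z) := by
    refine fun c => ⟨fun z => mul_nonneg (by positivity)
      (Finset.sum_nonneg fun l _ => (blockChannel_mem hV _).1 z), ?_⟩
    rw [← Finset.mul_sum, Finset.sum_comm]
    simp [(blockChannel_mem hV _).2, hL'.ne']
  set K : (Fin M → Fin L → Fin n → Fin 2) → ℝ := fun ω =>
    klDivergence (fun z => (1 / (M : ℝ)) * ∑ m, v (ω m) z) (productDist (V 0) n) with hK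
  set T : (Fin M → Fin L → Fin n → Fin 2) → Fin M → ℝ := fun ω m =>
    Real.exp (∑ l, f (ω m l)) * Real.exp (-(L * lam)) with hT
  set U : (Fin M → Fin L → Fin n → Fin 2) → Fin M → Fin M → ℝ := fun ω m m' =>
    if m ≠ m' then Real.exp (∑ l, mass (blockChannel W (ω m' l)) (D (ω m))) *
      Real.exp (-(L * lam)) else 0 with hU
  -- The mean relative entropy at the warden.
  have hKmean : ∑ ω, productDist q M ω * K ω ≤
      (Fintype.card Z : ℝ) ^ n / M + n * klDivergence (mixOutput V α) (V 0) := by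
    refine (mean_klDivergence_average_le hqm hvm (R := productDist (mixOutput V α) n)
      ?_ ?_ ?_ hM).trans (le_of_eq ?_)
    · intro z
      have : ∀ c, q c * v c z = (1 / (L : ℝ)) * ∑ l, q c * blockChannel V (c l) z := by
        intro c
        rw [hv, ← Finset.mul_sum]
        ring
      simp_rw [this]
      rw [← Finset.mul_sum, Finset.sum_comm]
      simp_rw [hq, mean_apply hpm _ (fun x => blockChannel V x z), hp, sum_bernoulli_blockChannel]
      simp [hL'.ne']
    · intro c z hz
      simp [hv, blockChannel_eq_zero hV hα0 hα1 hVac _ hz]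
    · exact absCont_productDist (mixOutput_absCont hVac α) n
    · rw [klDivergence_productDist (mixOutput_mem hV hα0 hα1.le) (mixOutput_absCont hVac α)]
      simp
  -- The mean numbers of errors of the first and of the second kind.
  have hTmean : ∀ m, ∑ ω, productDist q M ω * T ω m ≤ Real.exp (L * (2 * φ - lam)) := by
    intro m
    rw [hT, mean_apply hqm m (fun c => Real.exp (∑ l, f (c l)) * Real.exp (-(L * lam)))]
    simp_rw [← mul_assoc]
    rw [← Finset.sum_mul]
    calc _ ≤ Real.exp (L * (2 * ∑ x, p x * f x)) * Real.exp (-(L * lam)) := by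
          gcongr
          exact exp_moment_le hpm L (fun x => mass_nonneg (blockChannel_mem hW x).1 _)
            (fun x => mass_le_one (blockChannel_mem hW x) _)
      _ ≤ _ := by
          rw [← Real.exp_add]
          refine Real.exp_le_exp.2 ?_
          nlinarith
  have hUmean : ∀ m m', ∑ ω, productDist q M ω * U ω m m' ≤ Real.exp (L * (2 * π - lam)) := by
    intro m m'
    by_cases hmm : m = m'
    · simp only [hU, hmm, ne_eq, not_true_eq_false, if_false, mul_zero, Finset.sum_const_zero]
      positivity
    · simp only [hU, ne_eq, hmm, not_false_eq_true, if_true]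
      have h1 := sum_prod_mul_apply₂ (p := fun _ : Fin M => q) (fun _ => hqm.2) hmm
        (fun c c' => Real.exp (∑ l, mass (blockChannel W (c' l)) (D c)) * Real.exp (-(L * lam)))
      simp only [productDist] at h1 ⊢
      rw [h1]
      calc _ ≤ ∑ c, q c * Real.exp (L * (2 * π - lam)) := by
            refine Finset.sum_le_sum fun c _ => mul_le_mul_of_nonneg_left ?_ (hqm.1 c)
            simp_rw [← mul_assoc]
            rw [← Finset.sum_mul]
            have h2 := exp_moment_le hpm L (g := fun x => mass (blockChannel W x) (D c))
              (fun x => mass_nonneg (blockChannel_mem hW x).1 _)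
              (fun x => mass_le_one (blockChannel_mem hW x) _)
            have h3 : ∑ x, p x * mass (blockChannel W x) (D c) ≤ π := by
              rw [sum_mul_mass]
              simp_rw [hp, sum_bernoulli_blockChannel]
              exact hπ _ (mass_thresholdRegion_le hW γ c)
            calc _ ≤ Real.exp (L * (2 * ∑ x, p x * mass (blockChannel W x) (D c))) *
                  Real.exp (-(L * lam)) := by
                  gcongr
              _ ≤ _ := by
                  rw [← Real.exp_add]
                  refine Real.exp_le_exp.2 ?_
                  nlinarith
        _ = _ := by rw [← Finset.sum_mul, hqm.2, one_mul]
  have hmean : ∑ ω, productDist q M ω * (K ω / δ + ∑ m, T ω m + ∑ m, ∑ m', U ω m m') < 1 := by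
    refine lt_of_le_of_lt ?_ hsum
    have h1 : ∑ ω, productDist q M ω * (K ω / δ + ∑ m, T ω m + ∑ m, ∑ m', U ω m m') =
        (∑ ω, productDist q M ω * K ω) / δ + ∑ m, ∑ ω, productDist q M ω * T ω m +
          ∑ m, ∑ m', ∑ ω, productDist q M ω * U ω m m' := by
      simp_rw [mul_add, Finset.sum_add_distrib, Finset.mul_sum]
      rw [Finset.sum_div, Finset.sum_comm (γ := Fin M)]
      simp_rw [mul_div_assoc]
      congr 1
      rw [Finset.sum_comm]
      exact Finset.sum_congr rfl fun m _ => Finset.sum_comm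
    rw [h1]
    gcongr
    · calc _ ≤ ∑ m : Fin M, Real.exp (L * (2 * φ - lam)) := Finset.sum_le_sum fun m _ => hTmean m
        _ = _ := by simp
    · calc _ ≤ ∑ m : Fin M, ∑ m' : Fin M, Real.exp (L * (2 * π - lam)) :=
            Finset.sum_le_sum fun m _ => Finset.sum_le_sum fun m' _ => hUmean m m'
        _ = _ := by
          simp
          ring
  obtain ⟨ω, hω⟩ := exists_lt_of_mean_lt (productDist_mem hqm M) hmean
  have hwarden : (listCode hM hL D ω).wardenOutput V =
      fun z => (1 / (M : ℝ)) * ∑ m, v (ω m) z := by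
    funext z
    rw [IdCode.wardenOutput]
    refine congrArg _ (Finset.sum_congr rfl fun m _ => ?_)
    exact sum_listCode_codeword_mul hM hL D ω m (fun x => blockChannel V x z)
  have hT0 : ∀ m, 0 ≤ T ω m := fun m => by positivity
  have hU0 : ∀ m m', 0 ≤ U ω m m' := fun m m' => by
    simp only [hU]
    split_ifs <;> positivity
  have hK0 : 0 ≤ K ω / δ := by
    refine div_nonneg ?_ hδ.le
    have hac : AbsCont (fun z => (1 / (M : ℝ)) * ∑ m, v (ω m) z) (productDist (V 0) n) := by
      intro z hz
      have := absCont_productDist (mixOutput_absCont hVac α) n z hz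
      simp [hv, blockChannel_eq_zero hV hα0 hα1 hVac _ this]
    refine klDivergence_nonneg ⟨fun z => mul_nonneg (by positivity)
      (Finset.sum_nonneg fun m _ => (hvm _).1 z), ?_⟩ (productDist_mem (hV 0) n) hac
    rw [← Finset.mul_sum, Finset.sum_comm]
    simp [(hvm _).2, hM.ne']
  have hTs := Finset.sum_nonneg fun m (_ : m ∈ Finset.univ) => hT0 m
  have hUs := Finset.sum_nonneg fun m (_ : m ∈ Finset.univ) =>
    Finset.sum_nonneg fun m' (_ : m' ∈ Finset.univ) => hU0 m m'
  -- A total below `1` forces every single term below `1`.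
  have hexp : ∀ s : ℝ, Real.exp s * Real.exp (-(L * lam)) < 1 → (1 / (L : ℝ)) * s ≤ lam := by
    intro s hs
    rw [← Real.exp_add, Real.exp_lt_one_iff] at hs
    rw [one_div, inv_mul_le_iff₀ hL']
    linarith
  have hTone : ∀ m, T ω m < 1 := fun m => by
    linarith [Finset.single_le_sum (fun m _ => hT0 m) (Finset.mem_univ m)]
  have hUone : ∀ m m', U ω m m' < 1 := fun m m' => by
    linarith [Finset.single_le_sum (fun m' _ => hU0 m m') (Finset.mem_univ m'),
      Finset.single_le_sum (f := fun m => ∑ m', U ω m m')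
        (fun m _ => Finset.sum_nonneg fun m' _ => hU0 m m') (Finset.mem_univ m)]
  refine ⟨listCode hM hL D ω, rfl, ?_, fun m => ?_, fun m m' hmm => ?_, fun m => ?_⟩
  · rw [IdCode.IsCovert, hwarden]
    have : K ω / δ < 1 := by linarith
    rw [div_lt_one hδ] at this
    exact this.le
  · refine (le_of_eq (sum_listCode_codeword_mul hM hL D ω m
      fun x => mass (blockChannel W x) (D (ω m))ᶜ)).trans ?_
    refine le_trans ?_ (hexp _ (hTone m))
    gcongr with l
    refine mass_mono (blockChannel_mem hW _).1 fun y hy => ?_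
    exact not_lt.1 fun h => hy ⟨l, h⟩
  · refine (le_of_eq (sum_listCode_codeword_mul hM hL D ω m'
      fun x => mass (blockChannel W x) (D (ω m)))).trans ?_
    have h1 : U ω m m' < 1 := hUone m m'
    have h2 : U ω m m' = Real.exp (∑ l, mass (blockChannel W (ω m' l)) (D (ω m))) *
        Real.exp (-(L * lam)) := if_pos hmm
    exact hexp _ (h2 ▸ h1)
  · exact mass_thresholdRegion_le hW γ _

end RandomCode

/-! ### Achievability -/

open Filter Topology

/-- The one-sided first-order bound on the moment generating function, with an arbitrarily small
loss `η`. -/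
theorem exists_exp_moment_le {A : Type*} [Fintype A] {p : A → ℝ} (hp : p ∈ stdSimplex ℝ A)
    (g : A → ℝ) {η : ℝ} (hη : 0 < η) :
    ∃ s : ℝ, 0 < s ∧ ∑ a, p a * Real.exp (s * g a) ≤ 1 + s * (∑ a, p a * g a + η) := by
  obtain ⟨C, hC, s₀, hs₀, h⟩ := exists_exp_moment_expansion hp.1 g
  set G := ∑ a, p a * g a ^ 2 with hG
  have hG0 : 0 ≤ G := Finset.sum_nonneg fun a _ => mul_nonneg (hp.1 a) (sq_nonneg _)
  set s := min (min s₀ 1) (η / (G + C + 1)) with hs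
  have hspos : 0 < s := lt_min (lt_min hs₀ one_pos) (by positivity)
  have h1 : s ≤ 1 := (min_le_left _ _).trans (min_le_right _ _)
  have h2 : s ≤ s₀ := (min_le_left _ _).trans (min_le_left _ _)
  have h3 : s * (G + C + 1) ≤ η := (le_div_iff₀ (by positivity)).1 (min_le_right _ _)
  refine ⟨s, hspos, (h s (by rwa [abs_of_pos hspos])).trans ?_⟩
  rw [hp.2, abs_of_pos hspos]
  have h4 : s ^ 2 / 2 * G + C * s ^ 3 ≤ s * η := by
    have h5 : s * (s * (G + C + 1)) ≤ s * η := mul_le_mul_of_nonneg_left h3 hspos.le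
    have h6 : 0 ≤ s ^ 2 * G := by positivity
    have h7 : 0 ≤ s ^ 2 * C * (1 - s) := mul_nonneg (by positivity) (by linarith)
    nlinarith
  linarith

/-- With inputs that are `1` with probability `α`, the information density stays below a threshold
`γ` smaller than its mean `n α D` only with exponentially small probability. -/
theorem exists_mean_mass_below_le {Y : Type*} [Fintype Y] {W : Fin 2 → Y → ℝ}
    (hW : IsBinaryChannel W) (hac : AbsCont (W 1) (W 0)) {η : ℝ} (hη : 0 < η) :
    ∃ s : ℝ, 0 < s ∧ ∀ (n : ℕ) (α γ : ℝ), 0 ≤ α → α ≤ 1 →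
      ∑ x : Fin n → Fin 2, productDist (bernoulli α) n x * mass (blockChannel W x)
        {y | blockChannel W x y ≤ Real.exp γ * productDist (W 0) n y} ≤
      Real.exp (s * (γ - n * α * (klDivergence (W 1) (W 0) - η))) := by
  obtain ⟨s, hs, h⟩ := exists_exp_moment_le (hW 1)
    (fun a => -Real.log (W 1 a / W 0 a)) hη
  refine ⟨s, hs, fun n α γ h0 h1 => ?_⟩
  set m := ∑ a, W 1 a * Real.exp (-s * Real.log (W 1 a / W 0 a)) with hm
  have hm0 : 0 ≤ m :=
    Finset.sum_nonneg fun a _ => mul_nonneg ((hW 1).1 a) (Real.exp_nonneg _)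
  have hm1 : m - 1 ≤ -(s * (klDivergence (W 1) (W 0) - η)) := by
    simp only [mul_neg, Finset.sum_neg_distrib] at h
    simp only [hm, klDivergence, neg_mul]
    linarith
  have h2 : ∀ x : Fin n → Fin 2, mass (blockChannel W x)
      {y | blockChannel W x y ≤ Real.exp γ * productDist (W 0) n y} ≤
      Real.exp (s * γ) * m ^ weight x := by
    intro x
    have := mass_tail_le hW (-s) γ x
      (S := {y | blockChannel W x y ≤ Real.exp γ * productDist (W 0) n y}) ?_
    · simpa [hm] using this
    · intro y hy hxy
      change blockChannel W x y ≤ _ at hy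
      rw [blockChannel_eq_exp_infoDensity hW hac hxy] at hy
      have hpos : 0 < productDist (W 0) n y :=
        lt_of_le_of_ne ((productDist_mem (hW 0) n).1 y) fun h' => hxy (by
          rw [blockChannel_eq_exp_infoDensity hW hac hxy, ← h', mul_zero])
      have := Real.exp_le_exp.1 (le_of_mul_le_mul_right hy hpos)
      nlinarith
  calc _ ≤ ∑ x : Fin n → Fin 2, productDist (bernoulli α) n x *
        (Real.exp (s * γ) * m ^ weight x) :=
        Finset.sum_le_sum fun x _ => mul_le_mul_of_nonneg_left (h2 x)
          ((productDist_mem (bernoulli_mem h0 h1) n).1 x)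
    _ = Real.exp (s * γ) * ∑ x : Fin n → Fin 2, productDist (bernoulli α) n x * m ^ weight x := by
        rw [Finset.mul_sum]
        exact Finset.sum_congr rfl fun x _ => by ring
    _ ≤ Real.exp (s * γ) * Real.exp (n * (α * (m - 1))) := by
        gcongr
        exact sum_bernoulli_pow_weight_le h0 h1 hm0
    _ ≤ _ := by
        rw [← Real.exp_add]
        refine Real.exp_le_exp.2 ?_
        have : n * α * (m - 1) ≤ n * α * -(s * (klDivergence (W 1) (W 0) - η)) := by gcongr
        linarith

theorem tendsto_exp_neg_mul {c : ℝ} (hc : 0 < c) :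
    Tendsto (fun r : ℝ => Real.exp (-(c * r))) atTop (𝓝 0) :=
  Real.tendsto_exp_neg_atTop_nhds_zero.comp (tendsto_id.const_mul_atTop hc)

theorem tendsto_exp_sub_exp {a b c : ℝ} (hb : 0 < b) (hc : 0 < c) :
    Tendsto (fun r : ℝ => Real.exp (a * r ^ 2 - c * Real.exp (b * r))) atTop (𝓝 0) := by
  refine Real.tendsto_exp_atBot.comp ?_
  have h1 : Tendsto (fun r : ℝ => r ^ 2 * Real.exp (-(b * r))) atTop (𝓝 0) := by
    have := isLittleO_pow_exp_pos_mul_atTop (k := 2) hb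
    refine this.tendsto_div_nhds_zero.congr fun r => ?_
    rw [Real.exp_neg]
    rfl
  have h2 : Tendsto (fun r : ℝ => a * (r ^ 2 * Real.exp (-(b * r))) - c) atTop (𝓝 (a * 0 - c)) :=
    (h1.const_mul a).sub_const c
  have h3 : Tendsto (fun r : ℝ => Real.exp (b * r)) atTop atTop :=
    Real.tendsto_exp_atTop.comp (tendsto_id.const_mul_atTop hb)
  refine (h3.atTop_mul_neg (by linarith) h2).congr fun r => ?_
  have : Real.exp (b * r) * Real.exp (-(b * r)) = 1 := by
    rw [← Real.exp_add, add_neg_cancel, Real.exp_zero]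
  linear_combination a * r ^ 2 * this

set_option maxHeartbeats 1000000 in
/-- Random codes of the rate `R` exist for all large blocklengths; `t / √n` is the probability of the
symbol `1`, and covertness allows every `t` below `√(2 δ / χ₂)`. -/
theorem eventually_exists_idCode {Y Z : Type*} [Fintype Y] [Fintype Z] {W : Fin 2 → Y → ℝ}
    {V : Fin 2 → Z → ℝ} (hW : IsBinaryChannel W) (hV : IsBinaryChannel V)
    (hVac : AbsCont (V 1) (V 0)) (hWac : AbsCont (W 1) (W 0)) {δ : ℝ} (hδ : 0 < δ) {R t : ℝ}
    (hR : 0 < R) (ht : 0 < t) (hRt : R < t * klDivergence (W 1) (W 0))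
    (htδ : t ^ 2 / 2 * chiSquare (V 1) (V 0) < δ) :
    ∃ κ : ℝ, 0 < κ ∧ ∀ᶠ n : ℕ in atTop, ∃ C : IdCode Y n, (R : EReal) ≤ C.rate ∧
      C.IsCovert V δ ∧ C.maxErr1 W ≤ Real.exp (-(κ * √n)) ∧
      C.maxErr2 W ≤ Real.exp (-(κ * √n)) ∧ C.maxErr3 W ≤ 2 * Real.exp (-(κ * √n)) := by
  set D := klDivergence (W 1) (W 0) with hD
  set χ := chiSquare (V 1) (V 0) with hχ
  -- The gap `t D - R` is shared between the list size, the threshold and the information density.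
  obtain ⟨ε, hε, htD⟩ : ∃ ε : ℝ, 0 < ε ∧ t * D = R + 3 * ε :=
    ⟨(t * D - R) / 3, by linarith, by ring⟩
  obtain ⟨s, hs, hφ⟩ := exists_mean_mass_below_le hW hWac (η := ε / (2 * t)) (by positivity)
  obtain ⟨B, hB, α₀, hα₀, hKL⟩ := exists_klDivergence_mixOutput_le hV hVac
  set κ := min (s * ε) ε / 4 with hκ
  have hκ0 : 0 < κ := by
    have : 0 < min (s * ε) ε := lt_min (by positivity) hε
    positivity
  have hκ1 : 4 * κ ≤ s * ε := by rw [hκ]; linarith [min_le_left (s * ε) ε]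
  have hκ2 : 4 * κ ≤ ε := by rw [hκ]; linarith [min_le_right (s * ε) ε]
  set G := Real.exp (t ^ 2 * chiSquare (W 1) (W 0)) with hG
  refine ⟨κ, hκ0, ?_⟩
  have hrt : Tendsto (fun n : ℕ => √(n : ℝ)) atTop atTop :=
    Real.tendsto_sqrt_atTop.comp tendsto_natCast_atTop_atTop
  have hev1 : ∀ᶠ r : ℝ in atTop, (Real.exp ((Fintype.card Z : ℝ) * r ^ 2 - 1 * Real.exp (R * r)) +
      (t ^ 2 / 2 * χ + B * t ^ 3 / r)) / δ + 6 * Real.exp (0 * r ^ 2 - 2 * Real.exp (R * r)) < 1 := by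
    have h1 := tendsto_exp_sub_exp (a := (Fintype.card Z : ℝ)) hR one_pos
    have h2 := (tendsto_exp_sub_exp (a := 0) hR two_pos).const_mul 6
    have h3 : Tendsto (fun r : ℝ => B * t ^ 3 / r) atTop (𝓝 0) :=
      tendsto_const_nhds.div_atTop tendsto_id
    have h4 := ((h1.add (h3.const_add (t ^ 2 / 2 * χ))).div_const δ).add h2
    refine h4.eventually_lt_const ?_
    rw [mul_zero, add_zero, add_zero, zero_add, div_lt_one hδ]
    exact htδ
  have hev2 : ∀ᶠ r : ℝ in atTop, 8 + 4 * (2 + G) ≤ Real.exp (κ * r) :=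
    (Real.tendsto_exp_atTop.comp (tendsto_id.const_mul_atTop hκ0)).eventually_ge_atTop _
  have hev3 : ∀ᶠ r : ℝ in atTop, max (t / α₀) (2 * t) ≤ r ∧ 0 < r :=
    (eventually_ge_atTop _).and (eventually_gt_atTop 0)
  filter_upwards [hrt.eventually hev1, hrt.eventually hev2, hrt.eventually hev3]
    with n h1 h2 ⟨h3, hr⟩
  have hn : (n : ℝ) = √(n : ℝ) ^ 2 := (Real.sq_sqrt n.cast_nonneg).symm
  set r := √(n : ℝ) with hrdef
  have hG0 : 0 < G := Real.exp_pos _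
  have hα0 : 0 ≤ t / r := by positivity
  have hα1 : t / r ≤ 1 / 2 := by
    rw [div_le_iff₀ hr]
    linarith [(le_max_right _ _).trans h3]
  have hα2 : t / r ≤ α₀ := by
    rw [div_le_comm₀ hr hα₀]
    exact (le_max_left _ _).trans h3
  have hnα : (n : ℝ) * (t / r) = t * r := by
    rw [hn]
    field_simp
  set M := ⌈Real.exp (Real.exp (R * r))⌉₊ with hMdef
  set L := ⌈Real.exp ((R + ε) * r)⌉₊ with hLdef
  have hM1 : Real.exp (Real.exp (R * r)) ≤ M := Nat.le_ceil _
  have hM2 : (M : ℝ) ≤ 2 * Real.exp (Real.exp (R * r)) := by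
    have := (Nat.ceil_lt_add_one (Real.exp_nonneg (Real.exp (R * r)))).le
    linarith [Real.one_le_exp (Real.exp_nonneg (R * r))]
  have hL1 : Real.exp ((R + ε) * r) ≤ L := Nat.le_ceil _
  have hL2 : (L : ℝ) ≤ 2 * Real.exp ((R + ε) * r) := by
    have := (Nat.ceil_lt_add_one (Real.exp_nonneg ((R + ε) * r))).le
    linarith [Real.one_le_exp (show 0 ≤ (R + ε) * r by positivity)]
  have hM : 0 < M := Nat.ceil_pos.2 (Real.exp_pos _)
  have hL : 0 < L := Nat.ceil_pos.2 (Real.exp_pos _)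
  set γ := (R + 2 * ε) * r with hγ
  set lam := Real.exp (-(κ * r)) with hlam
  have hlam0 : 0 < lam := Real.exp_pos _
  have hLγ : L * Real.exp (-γ) ≤ 2 * Real.exp (-(ε * r)) := by
    calc _ ≤ 2 * Real.exp ((R + ε) * r) * Real.exp (-γ) := by gcongr
      _ = _ := by
        rw [mul_assoc, ← Real.exp_add]
        congr 2
        rw [hγ]
        ring
  have hκlam : Real.exp (-(2 * κ * r)) * Real.exp (κ * r) = lam := by
    rw [← Real.exp_add, hlam]
    congr 1
    ring
  have hsmall : ∀ c : ℝ, c ≤ 8 + 4 * (2 + G) → c * Real.exp (-(2 * κ * r)) ≤ lam := fun c hc => by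
    rw [← hκlam, mul_comm]
    exact mul_le_mul_of_nonneg_left (hc.trans h2) (Real.exp_nonneg _)
  have hφ' := hφ n (t / r) γ hα0 (by linarith)
  have hφlam : 4 * Real.exp (s * (γ - n * (t / r) * (D - ε / (2 * t)))) ≤ lam := by
    refine le_trans ?_ (hsmall 4 (by linarith))
    gcongr
    rw [hnα, hγ]
    have h5 : t * (D - ε / (2 * t)) = R + 3 * ε - ε / 2 := by
      rw [mul_sub, htD]
      field_simp
    have h6 : s * ((R + 2 * ε) * r - t * r * (D - ε / (2 * t))) = -(s * ε / 2 * r) := by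
      linear_combination (-s * r) * h5
    rw [h6]
    nlinarith
  set π := (2 + G) * Real.exp (-(ε / 2 * r)) with hπdef
  have hπlam : 4 * π ≤ lam := by
    rw [hπdef, ← mul_assoc]
    refine le_trans ?_ (hsmall (4 * (2 + G)) (by linarith))
    gcongr
    linarith
  have hπ : ∀ S : Set (Fin n → Y), mass (productDist (W 0) n) S ≤ L * Real.exp (-γ) →
      mass (productDist (mixOutput W (t / r)) n) S ≤ π := by
    intro S hS
    refine (mass_le_of_second_moment
      (productDist_mem (mixOutput_mem hW hα0 (by linarith)) n).1 (productDist_mem (hW 0) n).1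
      (absCont_productDist (mixOutput_absCont hWac _) n) (Real.exp_pos (ε / 2 * r)) S).trans ?_
    have h5 := second_moment_mixOutput_le hW hWac (t / r) n
    have h6 : (n : ℝ) * ((t / r) ^ 2 * chiSquare (W 1) (W 0)) = t ^ 2 * chiSquare (W 1) (W 0) := by
      rw [hn]
      field_simp
    rw [h6] at h5
    calc _ ≤ Real.exp (ε / 2 * r) * (2 * Real.exp (-(ε * r))) + G / Real.exp (ε / 2 * r) := by
          gcongr
          exact hS.trans hLγ
      _ = π := by
          have h7 : Real.exp (ε / 2 * r) * Real.exp (-(ε * r)) = Real.exp (-(ε / 2 * r)) := by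
            rw [← Real.exp_add]
            congr 1
            ring
          have h8 : G / Real.exp (ε / 2 * r) = G * Real.exp (-(ε / 2 * r)) := by
            rw [Real.exp_neg]
            rfl
          rw [h8, hπdef, ← h7]
          ring
  have hexp : ∀ c : ℝ, 4 * c ≤ lam →
      Real.exp (L * (2 * c - lam)) ≤ Real.exp (-(4 * Real.exp (R * r))) := by
    intro c hc
    refine Real.exp_le_exp.2 ?_
    have h5 : Real.exp ((R + ε) * r) * lam = Real.exp (R * r) * Real.exp ((ε - κ) * r) := by
      rw [hlam, ← Real.exp_add, ← Real.exp_add]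
      congr 1
      ring
    have h6 : 8 ≤ Real.exp ((ε - κ) * r) := by
      have : Real.exp (κ * r) ≤ Real.exp ((ε - κ) * r) := by
        gcongr
        linarith
      linarith
    have h7 := mul_le_mul_of_nonneg_left h6 (Real.exp_nonneg (R * r))
    have h8 := mul_le_mul_of_nonneg_right hL1 hlam0.le
    have h9 : L * (2 * c - lam) ≤ L * (-(lam / 2)) := by
      gcongr
      linarith
    linarith
  have hsum : ((Fintype.card Z : ℝ) ^ n / M + n * klDivergence (mixOutput V (t / r)) (V 0)) / δ +
      M * Real.exp (L * (2 * Real.exp (s * (γ - n * (t / r) * (D - ε / (2 * t)))) - lam)) +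
      M ^ 2 * Real.exp (L * (2 * π - lam)) < 1 := by
    refine lt_of_le_of_lt ?_ h1
    have h5 : (Fintype.card Z : ℝ) ^ n / M ≤
        Real.exp ((Fintype.card Z : ℝ) * r ^ 2 - 1 * Real.exp (R * r)) := by
      rw [one_mul, Real.exp_sub, ← hn, mul_comm (Fintype.card Z : ℝ), Real.exp_nat_mul]
      gcongr
      linarith [Real.add_one_le_exp (Fintype.card Z : ℝ)]
    have h6 : n * klDivergence (mixOutput V (t / r)) (V 0) ≤ t ^ 2 / 2 * χ + B * t ^ 3 / r := by
      calc _ ≤ n * ((t / r) ^ 2 / 2 * χ + B * (t / r) ^ 3) := by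
            gcongr
            exact hKL _ hα0 hα2
        _ = _ := by
            rw [hn]
            field_simp
    have h7 : (M : ℝ) * Real.exp (-(4 * Real.exp (R * r))) ≤
        2 * Real.exp (0 * r ^ 2 - 2 * Real.exp (R * r)) := by
      calc _ ≤ 2 * Real.exp (Real.exp (R * r)) * Real.exp (-(4 * Real.exp (R * r))) := by gcongr
        _ = 2 * Real.exp (-(3 * Real.exp (R * r))) := by
            rw [mul_assoc, ← Real.exp_add]
            congr 2
            ring
        _ ≤ _ := by
            gcongr
            linarith [Real.exp_pos (R * r)]
    have h8 : (M : ℝ) ^ 2 * Real.exp (-(4 * Real.exp (R * r))) ≤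
        4 * Real.exp (0 * r ^ 2 - 2 * Real.exp (R * r)) := by
      calc _ ≤ (2 * Real.exp (Real.exp (R * r))) ^ 2 * Real.exp (-(4 * Real.exp (R * r))) := by
            gcongr
        _ = _ := by
            rw [mul_pow, ← Real.exp_nat_mul, mul_assoc, ← Real.exp_add]
            norm_num
            ring
    have h9 : (M : ℝ) * Real.exp (L * (2 * Real.exp (s * (γ - n * (t / r) * (D - ε / (2 * t)))) -
        lam)) ≤ M * Real.exp (-(4 * Real.exp (R * r))) :=
      mul_le_mul_of_nonneg_left (hexp _ hφlam) (by positivity)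
    have h10 : (M : ℝ) ^ 2 * Real.exp (L * (2 * π - lam)) ≤
        M ^ 2 * Real.exp (-(4 * Real.exp (R * r))) :=
      mul_le_mul_of_nonneg_left (hexp _ hπlam) (by positivity)
    have h11 : ((Fintype.card Z : ℝ) ^ n / M + n * klDivergence (mixOutput V (t / r)) (V 0)) / δ ≤
        (Real.exp ((Fintype.card Z : ℝ) * r ^ 2 - 1 * Real.exp (R * r)) +
          (t ^ 2 / 2 * χ + B * t ^ 3 / r)) / δ := by
      gcongr
    linarith
  obtain ⟨C, hCM, hCδ, hC1, hC2, hC3⟩ := exists_idCode hW hV hVac hα0 (by linarith) hδ hM hL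
    hφ' hπ hsum
  refine ⟨C, ?_, hCδ, Real.iSup_le hC1 hlam0.le,
    Real.iSup_le (fun p => hC2 _ _ p.2) hlam0.le, Real.iSup_le (fun m => ?_) (by positivity)⟩
  · have hM3 : C.size ≠ 1 := by
      intro h
      rw [hCM] at h
      rw [h] at hM1
      have := Real.one_lt_exp_iff.2 (Real.exp_pos (R * r))
      push_cast at hM1
      linarith
    rw [IdCode.rate, if_neg hM3, EReal.coe_le_coe_iff, le_div_iff₀ hr, hCM,
      Real.le_log_iff_exp_le, Real.le_log_iff_exp_le]
    · exact hM1
    · exact_mod_cast hM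
    · refine Real.log_pos (lt_of_lt_of_le ?_ hM1)
      exact Real.one_lt_exp_iff.2 (Real.exp_pos _)
  · refine (hC3 m).trans (hLγ.trans (mul_le_mul_of_nonneg_left ?_ two_pos.le))
    exact Real.exp_le_exp.2 (neg_le_neg (mul_le_mul_of_nonneg_right (by linarith) hr.le))

/-- Codes that exist for all large blocklengths are completed by the code with one message that
always sends the innocent word. -/
theorem isAchievable_of_lt {Y Z : Type*} [Fintype Y] [Fintype Z] {W : Fin 2 → Y → ℝ}
    {V : Fin 2 → Z → ℝ} (hW : IsBinaryChannel W) (hV : IsBinaryChannel V)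
    (hVac : AbsCont (V 1) (V 0)) (hWac : AbsCont (W 1) (W 0)) {δ : ℝ} (hδ : 0 < δ) {R t : ℝ}
    (hR : 0 < R) (ht : 0 < t) (hRt : R < t * klDivergence (W 1) (W 0))
    (htδ : t ^ 2 / 2 * chiSquare (V 1) (V 0) < δ) {ν : ℕ → ℕ} (hν : StrictMono ν) :
    IsAchievable W V δ ν R := by
  obtain ⟨κ, hκ, hev⟩ := eventually_exists_idCode hW hV hVac hWac hδ hR ht hRt htδ
  have htriv : ∀ n : ℕ, ∃ C : IdCode Y n, C.IsCovert V δ := by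
    intro n
    refine ⟨⟨1, one_pos, fun _ x => if x = 0 then 1 else 0, fun _ => ⟨fun x => ?_, by simp⟩,
      fun _ => ∅⟩, ?_⟩
    · positivity
    · refine le_of_eq_of_le ?_ hδ.le
      rw [klDivergence]
      refine Finset.sum_eq_zero fun z _ => ?_
      simp only [IdCode.wardenOutput, ite_mul, one_mul, zero_mul, Finset.sum_ite_eq',
        Finset.mem_univ, if_true, Finset.univ_unique, Finset.sum_const, Finset.card_singleton,
        one_smul, Nat.cast_one, div_one]
      change productDist (V 0) n z * Real.log (productDist (V 0) n z / productDist (V 0) n z) = 0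
      by_cases h : productDist (V 0) n z = 0
      · simp [h]
      · simp [div_self h]
  have hchoice : ∀ n : ℕ, ∃ C : IdCode Y n, C.IsCovert V δ ∧
      ((∃ C : IdCode Y n, (R : EReal) ≤ C.rate ∧
        C.IsCovert V δ ∧ C.maxErr1 W ≤ Real.exp (-(κ * √n)) ∧
        C.maxErr2 W ≤ Real.exp (-(κ * √n)) ∧ C.maxErr3 W ≤ 2 * Real.exp (-(κ * √n))) →
      (R : EReal) ≤ C.rate ∧ C.maxErr1 W ≤ Real.exp (-(κ * √n)) ∧
        C.maxErr2 W ≤ Real.exp (-(κ * √n)) ∧ C.maxErr3 W ≤ 2 * Real.exp (-(κ * √n))) := by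
    intro n
    by_cases h : ∃ C : IdCode Y n, (R : EReal) ≤ C.rate ∧
        C.IsCovert V δ ∧ C.maxErr1 W ≤ Real.exp (-(κ * √n)) ∧
        C.maxErr2 W ≤ Real.exp (-(κ * √n)) ∧ C.maxErr3 W ≤ 2 * Real.exp (-(κ * √n))
    · obtain ⟨C, h1, h2, h3⟩ := h
      exact ⟨C, h2, fun _ => ⟨h1, h3⟩⟩
    · obtain ⟨C, hC⟩ := htriv n
      exact ⟨C, hC, fun h' => absurd h' h⟩
  choose C hC1 hC2 using hchoice
  have hev' := (hν.tendsto_atTop.eventually hev).mono fun k hk => hC2 (ν k) hk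
  have hlim : Tendsto (fun k => Real.exp (-(κ * √(ν k : ℝ)))) atTop (𝓝 0) :=
    (tendsto_exp_neg_mul hκ).comp (Real.tendsto_sqrt_atTop.comp
      (tendsto_natCast_atTop_atTop.comp hν.tendsto_atTop))
  refine ⟨fun k => C (ν k),
    Filter.le_liminf_of_le (by isBoundedDefault) (hev'.mono fun k hk => hk.1),
    fun k => hC1 _, ?_, ?_, ?_⟩
  · refine squeeze_zero' (Eventually.of_forall fun k => ?_) (hev'.mono fun k hk => hk.2.1) hlim
    exact Real.iSup_nonneg fun m => Finset.sum_nonneg fun x _ =>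
      mul_nonneg (((C _).codeword_mem m).1 x) (mass_nonneg (blockChannel_mem hW x).1 _)
  · refine squeeze_zero' (Eventually.of_forall fun k => ?_) (hev'.mono fun k hk => hk.2.2.1) hlim
    exact Real.iSup_nonneg fun m => Finset.sum_nonneg fun x _ =>
      mul_nonneg (((C _).codeword_mem _).1 x) (mass_nonneg (blockChannel_mem hW x).1 _)
  · refine squeeze_zero' (Eventually.of_forall fun k => ?_) (hev'.mono fun k hk => hk.2.2.2)
      (by simpa using hlim.const_mul 2)
    exact Real.iSup_nonneg fun m => mass_nonneg (productDist_mem (hW 0) _).1 _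

/-! ### Covertness bounds the weight of the codewords -/

/-- Covertness bounds the mean weight of the input. This is the Donsker–Varadhan inequality for a
small multiple of the sum of the scores, a function which has mean `χ₂` per non-innocent symbol. -/
theorem exists_mean_weight_le {Z : Type*} [Fintype Z] {V : Fin 2 → Z → ℝ} (hV : IsBinaryChannel V)
    (hac : AbsCont (V 1) (V 0)) (hne : V 1 ≠ V 0) {δ : ℝ} (hδ : 0 < δ) :
    ∃ c₀ : ℝ, ∀ᶠ n : ℕ in atTop, ∀ p ∈ stdSimplex ℝ (Fin n → Fin 2),
      klDivergence (fun z => ∑ x, p x * blockChannel V x z) (productDist (V 0) n) ≤ δ →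
      ∑ x, p x * (weight x : ℝ) ≤ √(2 * δ / chiSquare (V 1) (V 0)) * √(n : ℝ) + c₀ := by
  have hχ := chiSquare_pos hV hac hne
  set χ := chiSquare (V 1) (V 0) with hχdef
  set w := √(2 * δ / χ) with hw
  have hw0 : 0 < w := Real.sqrt_pos.2 (by positivity)
  have hw2 : w ^ 2 * χ = 2 * δ := by
    rw [hw, Real.sq_sqrt (by positivity)]
    field_simp
  obtain ⟨B, hB, s₀, hs₀, hs⟩ := exists_exp_moment_expansion (hV 0).1 (score V)
  refine ⟨B * w ^ 2 / χ, ?_⟩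
  have hrt : Tendsto (fun n : ℕ => √(n : ℝ)) atTop atTop :=
    Real.tendsto_sqrt_atTop.comp tendsto_natCast_atTop_atTop
  filter_upwards [hrt.eventually (eventually_ge_atTop (w / s₀)),
    hrt.eventually (eventually_gt_atTop 0)] with n h1 hr p hp hKL
  have hn : (n : ℝ) = √(n : ℝ) ^ 2 := (Real.sq_sqrt n.cast_nonneg).symm
  set r := √(n : ℝ) with hrdef
  set s := w / r with hsdef
  have hs0 : 0 < s := by positivity
  have hss : s ≤ s₀ := by
    rw [hsdef, div_le_comm₀ hr hs₀]
    exact h1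
  set P : (Fin n → Z) → ℝ := fun z => ∑ x, p x * blockChannel V x z with hP
  have hPmem : P ∈ stdSimplex ℝ (Fin n → Z) := by
    refine ⟨fun z => Finset.sum_nonneg fun x _ =>
      mul_nonneg (hp.1 x) ((blockChannel_mem hV x).1 z), ?_⟩
    rw [Finset.sum_comm]
    simp [← Finset.mul_sum, (blockChannel_mem hV _).2, hp.2]
  have hPac : AbsCont P (productDist (V 0) n) := by
    intro z hz
    have : productDist (mixOutput V 0) n z = 0 := by
      simpa [productDist, mixOutput] using hz
    simp [hP, blockChannel_eq_zero hV le_rfl one_pos hac _ this]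
  have hDV := mean_le_klDivergence_add_log hPmem (productDist_mem (hV 0) n).1 hPac
    (fun z => ∑ i, s * score V (z i))
  have hmean : ∑ z, P z * ∑ i, s * score V (z i) = s * χ * ∑ x, p x * (weight x : ℝ) := by
    have h2 : ∀ x : Fin n → Fin 2,
        ∑ z, blockChannel V x z * ∑ i, s * score V (z i) = s * χ * weight x := by
      intro x
      simp_rw [Finset.mul_sum]
      rw [Finset.sum_comm, weight, Nat.cast_sum, Finset.mul_sum]
      refine Finset.sum_congr rfl fun i _ => ?_
      simp only [blockChannel]
      rw [sum_prod_mul_apply (p := fun i => V (x i)) (fun i => (hV (x i)).2) i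
        (fun a => s * score V a)]
      simp_rw [mul_left_comm _ s]
      rw [← Finset.mul_sum, mul_assoc]
      by_cases hx : x i = 1
      · simp [hx, sum_one_mul_score hV hac, hχdef]
      · have : x i = 0 := by
          by_contra h'
          exact hx (Fin.eq_one_of_ne_zero _ h')
        simp [this, sum_mul_score hV hac]
    simp only [hP, Finset.sum_mul]
    rw [Finset.sum_comm, Finset.mul_sum]
    refine Finset.sum_congr rfl fun x _ => ?_
    simp_rw [mul_assoc (p x)]
    rw [← Finset.mul_sum, h2]
    ring
  have hlog : Real.log (∑ z, productDist (V 0) n z * Real.exp (∑ i, s * score V (z i))) ≤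
      n * (s ^ 2 / 2 * χ + B * s ^ 3) := by
    rw [sum_productDist_mul_exp (V 0) n (fun a => s * score V a), Real.log_pow]
    have h2 := hs s (by rwa [abs_of_pos hs0])
    rw [(hV 0).2, sum_mul_score hV hac, sum_mul_score_sq hac, abs_of_pos hs0] at h2
    have h3 : 0 ≤ ∑ a, V 0 a * Real.exp (s * score V a) :=
      Finset.sum_nonneg fun a _ => mul_nonneg ((hV 0).1 a) (Real.exp_nonneg _)
    gcongr
    rcases h3.eq_or_lt with h4 | h4
    · rw [← h4, Real.log_zero]
      positivity
    · have := Real.log_le_sub_one_of_pos h4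
      linarith
  rw [hmean] at hDV
  have h5 : n * (s ^ 2 / 2 * χ + B * s ^ 3) = δ + B * w ^ 3 / r := by
    rw [hn, hsdef]
    field_simp
    linear_combination r * hw2
  have h6 : s * χ * (w * r + B * w ^ 2 / χ) = δ + (δ + B * w ^ 3 / r) := by
    rw [hsdef]
    field_simp
    linear_combination r * hw2
  refine le_of_mul_le_mul_left (a := s * χ) ?_ (by positivity)
  linarith

/-! ### Approximation of output distributions -/

/-- Soft covering: if the likelihood ratio with respect to a reference distribution `Q` is mostly
below `T`, then about `T` inputs, used with equal probabilities, suffice to approximate the output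
distribution of an arbitrary input distribution `U` in total variation. -/
theorem exists_list_approx {X Y : Type*} [Fintype X] [Fintype Y] {U : X → ℝ}
    (hU : U ∈ stdSimplex ℝ X) {K : X → Y → ℝ} (hK : ∀ x, K x ∈ stdSimplex ℝ Y) {Q : Y → ℝ}
    (hQ : Q ∈ stdSimplex ℝ Y) {T θ η τ : ℝ} (hθ : 0 < θ) {L : ℕ} (hL : 0 < L)
    (hTL : T ≤ θ ^ 2 * L) (hη : ∑ x, U x * mass (K x) {y | T * Q y < K x y} ≤ η)
    (hτ : θ + 2 * η < τ) :
    ∃ c : Fin L → X, ∀ S : Set Y,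
      |(1 / (L : ℝ)) * ∑ l, mass (K (c l)) S - ∑ x, U x * mass (K x) S| ≤ τ := by
  classical
  have hL' : (0 : ℝ) < L := by exact_mod_cast hL
  -- The kernel is split into a bounded part `A` and a part `β` of small mass.
  set A : X → Y → ℝ := fun x y => if T * Q y < K x y then 0 else K x y with hA
  set β : X → Y → ℝ := fun x y => if T * Q y < K x y then K x y else 0 with hβ
  have hA0 : ∀ x y, 0 ≤ A x y := fun x y => by
    simp only [hA]
    split_ifs
    exacts [le_rfl, (hK x).1 y]
  have hβ0 : ∀ x y, 0 ≤ β x y := fun x y => by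
    simp only [hβ]
    split_ifs
    exacts [(hK x).1 y, le_rfl]
  have hAβ : ∀ x y, K x y = A x y + β x y := fun x y => by
    simp only [hA, hβ]
    split_ifs <;> simp
  have hβs : ∀ x, ∑ y, β x y = mass (K x) {y | T * Q y < K x y} := fun x => by
    rw [mass]
    refine Finset.sum_congr rfl fun y _ => ?_
    simp [hβ, Set.indicator_apply]
  set μ : Y → ℝ := fun y => ∑ x, U x * A x y with hμ
  set a : (Fin L → X) → Y → ℝ := fun c y => (1 / (L : ℝ)) * ∑ l, A (c l) y with ha
  have hmean : ∀ g : X → ℝ, ∑ c, productDist U L c * ((1 / (L : ℝ)) * ∑ l, g (c l)) =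
      ∑ x, U x * g x := by
    intro g
    simp_rw [mul_left_comm _ (1 / (L : ℝ))]
    rw [← Finset.mul_sum]
    simp_rw [Finset.mul_sum (s := (Finset.univ : Finset (Fin L)))]
    rw [Finset.sum_comm]
    simp_rw [mean_apply hU _ g]
    simp [hL'.ne']
  have hw := productDist_mem hU L
  have hvar : ∀ y, ∑ c, productDist U L c * (a c y - μ y) ^ 2 ≤ (T * Q y * μ y) / L := by
    intro y
    have h1 := second_moment_average_le hU hL (fun x => A x y)
    have h2 : ∑ x, U x * A x y ^ 2 ≤ T * Q y * μ y := by
      rw [hμ, Finset.mul_sum]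
      refine Finset.sum_le_sum fun x _ => ?_
      have h3 : A x y ^ 2 ≤ T * Q y * A x y := by
        rw [pow_two]
        simp only [hA]
        split_ifs with h
        · simp
        · exact mul_le_mul_of_nonneg_right (not_lt.1 h) ((hK x).1 y)
      nlinarith [hU.1 x]
    have h4 : ∑ c, productDist U L c * (a c y - μ y) ^ 2 =
        ∑ c, productDist U L c * a c y ^ 2 - μ y ^ 2 := by
      have h5 : ∀ c, productDist U L c * (a c y - μ y) ^ 2 = productDist U L c * a c y ^ 2 -
          2 * μ y * (productDist U L c * a c y) + productDist U L c * μ y ^ 2 := fun c => by ring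
      simp_rw [h5]
      rw [Finset.sum_add_distrib, Finset.sum_sub_distrib, ← Finset.mul_sum, ← Finset.sum_mul, hw.2,
        hmean (fun x => A x y)]
      simp only [hμ]
      ring
    rw [h4]
    have h6 : (∑ x, U x * A x y ^ 2) / L ≤ (T * Q y * μ y) / L := by gcongr
    linarith
  have habs : ∀ y, ∑ c, productDist U L c * |a c y - μ y| ≤ θ / 2 * Q y + θ / 2 * μ y := by
    intro y
    have hμ0 : 0 ≤ μ y := Finset.sum_nonneg fun x _ => mul_nonneg (hU.1 x) (hA0 x y)
    rcases (hQ.1 y).eq_or_lt with h | h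
    · have hA' : ∀ x, A x y = 0 := fun x => by
        simp only [hA, ← h, mul_zero]
        split_ifs with h'
        · rfl
        · exact le_antisymm (not_lt.1 h') ((hK x).1 y)
      simp [ha, hμ, hA', ← h]
    · have h1 : ∀ c, productDist U L c * |a c y - μ y| ≤ productDist U L c * (θ / 2 * Q y) +
          1 / (2 * (θ * Q y)) * (productDist U L c * (a c y - μ y) ^ 2) := by
        intro c
        have h2 : |a c y - μ y| ≤ θ / 2 * Q y + 1 / (2 * (θ * Q y)) * (a c y - μ y) ^ 2 := by
          have h3 : 0 ≤ (θ * Q y - |a c y - μ y|) ^ 2 / (2 * (θ * Q y)) := by positivity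
          have h4 : (θ * Q y - |a c y - μ y|) ^ 2 / (2 * (θ * Q y)) = θ / 2 * Q y +
              1 / (2 * (θ * Q y)) * |a c y - μ y| ^ 2 - |a c y - μ y| := by
            field_simp
            ring
          rw [sq_abs] at h4
          linarith
        have := mul_le_mul_of_nonneg_left h2 (hw.1 c)
        linarith
      refine (Finset.sum_le_sum fun c _ => h1 c).trans ?_
      rw [Finset.sum_add_distrib, ← Finset.sum_mul, hw.2, one_mul, ← Finset.mul_sum]
      refine add_le_add le_rfl ?_
      calc _ ≤ 1 / (2 * (θ * Q y)) * ((T * Q y * μ y) / L) := by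
            gcongr
            exact hvar y
        _ ≤ 1 / (2 * (θ * Q y)) * ((θ ^ 2 * L * Q y * μ y) / L) := by gcongr
        _ = _ := by field_simp
  have htotal : ∑ c, productDist U L c * (∑ y, |a c y - μ y| +
      (1 / (L : ℝ)) * ∑ l, ∑ y, β (c l) y + ∑ x, U x * ∑ y, β x y) < τ := by
    simp_rw [mul_add, Finset.sum_add_distrib]
    rw [hmean (fun x => ∑ y, β x y), ← Finset.sum_mul, hw.2, one_mul]
    simp_rw [hβs, Finset.mul_sum (s := (Finset.univ : Finset Y))]
    rw [Finset.sum_comm]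
    have h1 : ∑ y, μ y ≤ 1 := by
      have : ∀ y, μ y ≤ ∑ x, U x * K x y := fun y => Finset.sum_le_sum fun x _ =>
        mul_le_mul_of_nonneg_left (by linarith [hAβ x y, hβ0 x y]) (hU.1 x)
      refine (Finset.sum_le_sum fun y _ => this y).trans (le_of_eq ?_)
      rw [Finset.sum_comm]
      simp [← Finset.mul_sum, (hK _).2, hU.2]
    have h2 := Finset.sum_le_sum fun y (_ : y ∈ Finset.univ) => habs y
    rw [Finset.sum_add_distrib, ← Finset.mul_sum, ← Finset.mul_sum, hQ.2] at h2
    nlinarith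
  obtain ⟨c, hc⟩ := exists_lt_of_mean_lt hw htotal
  refine ⟨c, fun S => ?_⟩
  have h1 : (1 / (L : ℝ)) * ∑ l, mass (K (c l)) S - ∑ x, U x * mass (K x) S =
      ∑ y, S.indicator (fun y => (a c y - μ y) + (1 / (L : ℝ)) * ∑ l, β (c l) y -
        ∑ x, U x * β x y) y := by
    have h2 : (1 / (L : ℝ)) * ∑ l, mass (K (c l)) S = ∑ l, (1 / (L : ℝ)) * mass (K (c l)) S :=
      Finset.mul_sum _ _ _
    rw [h2, sum_mul_mass, sum_mul_mass, mass, mass, ← Finset.sum_sub_distrib]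
    refine Finset.sum_congr rfl fun y _ => ?_
    by_cases hy : y ∈ S
    · simp only [Set.indicator_of_mem hy, ha, hμ, hAβ, mul_add, Finset.sum_add_distrib,
        Finset.mul_sum]
      ring
    · simp [Set.indicator_of_notMem hy]
  rw [h1]
  refine (Finset.abs_sum_le_sum_abs _ _).trans (le_trans ?_ hc.le)
  have h2 : (1 / (L : ℝ)) * ∑ l, ∑ y, β (c l) y = ∑ y, (1 / (L : ℝ)) * ∑ l, β (c l) y := by
    rw [Finset.sum_comm, Finset.mul_sum]
  have h3 : ∑ x, U x * ∑ y, β x y = ∑ y, ∑ x, U x * β x y := by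
    simp_rw [Finset.mul_sum]
    exact Finset.sum_comm
  rw [h2, h3, ← Finset.sum_add_distrib, ← Finset.sum_add_distrib]
  refine Finset.sum_le_sum fun y _ => ?_
  have h4 : 0 ≤ (1 / (L : ℝ)) * ∑ l, β (c l) y :=
    mul_nonneg (by positivity) (Finset.sum_nonneg fun l _ => hβ0 _ _)
  have h5 : 0 ≤ ∑ x, U x * β x y := Finset.sum_nonneg fun x _ => mul_nonneg (hU.1 x) (hβ0 _ _)
  by_cases hy : y ∈ S
  · rw [Set.indicator_of_mem hy]
    refine (abs_sub _ _).trans ?_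
    rw [abs_of_nonneg h5]
    refine add_le_add ((abs_add_le _ _).trans ?_) le_rfl
    rw [abs_of_nonneg h4]
  · rw [Set.indicator_of_notMem hy, abs_zero]
    have := abs_nonneg (a c y - μ y)
    linarith

/-! ### Converse -/

/-- The information density of an input word exceeds a threshold `γ` larger than its mean only with
exponentially small probability. -/
theorem exists_mass_above_le {Y : Type*} [Fintype Y] {W : Fin 2 → Y → ℝ}
    (hW : IsBinaryChannel W) (hac : AbsCont (W 1) (W 0)) {η : ℝ} (hη : 0 < η) :
    ∃ s : ℝ, 0 < s ∧ ∀ (n : ℕ) (γ : ℝ) (x : Fin n → Fin 2),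
      mass (blockChannel W x) {y | Real.exp γ * productDist (W 0) n y < blockChannel W x y} ≤
      Real.exp (s * (weight x * (klDivergence (W 1) (W 0) + η) - γ)) := by
  obtain ⟨s, hs, h⟩ := exists_exp_moment_le (hW 1) (fun a => Real.log (W 1 a / W 0 a)) hη
  refine ⟨s, hs, fun n γ x => ?_⟩
  refine (mass_tail_le hW s γ x fun y hy hxy => ?_).trans ?_
  · change _ < blockChannel W x y at hy
    rw [blockChannel_eq_exp_infoDensity hW hac hxy] at hy
    have := Real.exp_lt_exp.1 (lt_of_mul_lt_mul_right hy ((productDist_mem (hW 0) n).1 y))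
    nlinarith
  · have h0 : 0 ≤ ∑ a, W 1 a * Real.exp (s * Real.log (W 1 a / W 0 a)) :=
      Finset.sum_nonneg fun a _ => mul_nonneg ((hW 1).1 a) (Real.exp_nonneg _)
    have h1 : ∑ a, W 1 a * Real.exp (s * Real.log (W 1 a / W 0 a)) ≤
        Real.exp (s * (klDivergence (W 1) (W 0) + η)) :=
      h.trans (by rw [add_comm]; exact Real.add_one_le_exp _)
    calc _ ≤ Real.exp (-(s * γ)) * Real.exp (s * (klDivergence (W 1) (W 0) + η)) ^ weight x := by
          gcongr
      _ = _ := by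
          rw [← Real.exp_nat_mul, ← Real.exp_add]
          congr 1
          ring

/-- The counting bound at a fixed blocklength. A proportion `κ` of the input mass is on words of
weight at most `b`; at least `κ / 2` of the messages then put mass at least `κ / 2` on such words.
Conditioned on them, their output distributions are approximated by lists of `L` words, and two
messages with the same list would not be distinguished. -/
theorem size_le_of_errors_le {Y : Type*} [Fintype Y] {W : Fin 2 → Y → ℝ} (hW : IsBinaryChannel W)
    {n : ℕ} (C : IdCode Y n) {b κ γ θ η τ e₁ e₂ : ℝ} {L : ℕ} (hκ : 0 < κ) (hL : 0 < L)
    (hθ : 0 < θ) (he₁ : ∀ m, C.err1 W m ≤ e₁) (he₂ : ∀ m m', m ≠ m' → C.err2 W m m' ≤ e₂)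
    (hlow : κ * C.size ≤ ∑ m, ∑ x, C.codeword m x * if (weight x : ℝ) ≤ b then 1 else 0)
    (hη : ∀ x : Fin n → Fin 2, (weight x : ℝ) ≤ b → mass (blockChannel W x)
      {y | Real.exp γ * productDist (W 0) n y < blockChannel W x y} ≤ η)
    (hLγ : Real.exp γ ≤ θ ^ 2 * L) (hτ : θ + 2 * η < τ)
    (hsmall : 2 / κ * (e₁ + e₂) + 2 * τ < 1) :
    κ / 2 * C.size ≤ (((2 ^ n) ^ L : ℕ) : ℝ) := by
  classical
  set low : Fin C.size → ℝ := fun m => ∑ x, C.codeword m x * if (weight x : ℝ) ≤ b then 1 else 0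
    with hlowdef
  have hlow1 : ∀ m, low m ≤ 1 := fun m => by
    rw [← (C.codeword_mem m).2]
    refine Finset.sum_le_sum fun x _ => ?_
    have := (C.codeword_mem m).1 x
    split_ifs <;> simp [this]
  set G : Finset (Fin C.size) := Finset.univ.filter fun m => κ / 2 ≤ low m with hG
  have hGcard : κ / 2 * C.size ≤ G.card := by
    have h1 : ∀ m, low m ≤ (if κ / 2 ≤ low m then 1 else 0) + κ / 2 := fun m => by
      split_ifs with h
      · linarith [hlow1 m]
      · linarith
    have h2 : ∑ m, low m ≤ G.card + C.size * (κ / 2) := by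
      refine (Finset.sum_le_sum fun m _ => h1 m).trans (le_of_eq ?_)
      rw [Finset.sum_add_distrib]
      simp [hG]
    linarith
  -- The input distribution of a message, conditioned on words of weight at most `b`.
  set U : Fin C.size → (Fin n → Fin 2) → ℝ := fun m x =>
    C.codeword m x * (if (weight x : ℝ) ≤ b then 1 else 0) / low m with hU
  have hlowpos : ∀ m ∈ G, 0 < low m := fun m hm => by
    have := (Finset.mem_filter.1 hm).2
    linarith
  have hUmem : ∀ m ∈ G, U m ∈ stdSimplex ℝ (Fin n → Fin 2) := by
    refine fun m hm => ⟨fun x => ?_, ?_⟩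
    · have := (C.codeword_mem m).1 x
      have := hlowpos m hm
      simp only [hU]
      split_ifs <;> positivity
    · simp only [hU]
      rw [← Finset.sum_div, div_self (hlowpos m hm).ne']
  have hUle : ∀ m ∈ G, ∀ g : (Fin n → Fin 2) → ℝ, (∀ x, 0 ≤ g x) →
      ∑ x, U m x * g x ≤ 2 / κ * ∑ x, C.codeword m x * g x := by
    intro m hm g hg
    rw [Finset.mul_sum]
    refine Finset.sum_le_sum fun x _ => ?_
    have h1 := (C.codeword_mem m).1 x
    have h2 := (Finset.mem_filter.1 hm).2
    have h3 : U m x ≤ 2 / κ * C.codeword m x := by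
      simp only [hU]
      rw [div_le_iff₀ (hlowpos m hm)]
      have h4 : C.codeword m x * (if (weight x : ℝ) ≤ b then 1 else 0) ≤ C.codeword m x := by
        split_ifs <;> simp [h1]
      have h5 : 2 / κ * C.codeword m x * (κ / 2) ≤ 2 / κ * C.codeword m x * low m := by gcongr
      have h6 : 2 / κ * C.codeword m x * (κ / 2) = C.codeword m x := by field_simp
      linarith
    calc _ ≤ 2 / κ * C.codeword m x * g x := mul_le_mul_of_nonneg_right h3 (hg x)
      _ = _ := mul_assoc _ _ _
  have happrox : ∀ m, ∃ c : Fin L → Fin n → Fin 2, m ∈ G → ∀ S : Set (Fin n → Y),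
      |(1 / (L : ℝ)) * ∑ l, mass (blockChannel W (c l)) S -
        ∑ x, U m x * mass (blockChannel W x) S| ≤ τ := by
    intro m
    by_cases hm : m ∈ G
    · have hmean : ∑ x, U m x * mass (blockChannel W x)
          {y | Real.exp γ * productDist (W 0) n y < blockChannel W x y} ≤ η := by
        calc _ ≤ ∑ x, U m x * η := by
              refine Finset.sum_le_sum fun x _ => ?_
              by_cases hx : (weight x : ℝ) ≤ b
              · exact mul_le_mul_of_nonneg_left (hη x hx) ((hUmem m hm).1 x)
              · simp [hU, hx]
          _ = η := by rw [← Finset.sum_mul, (hUmem m hm).2, one_mul]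
      obtain ⟨c, hc⟩ := exists_list_approx (hUmem m hm) (blockChannel_mem hW)
        (productDist_mem (hW 0) n) hθ hL hLγ hmean hτ
      exact ⟨c, fun _ => hc⟩
    · exact ⟨fun _ _ => 0, fun h => absurd h hm⟩
  choose c hc using happrox
  have hinj : Set.InjOn c G := by
    intro m hm m' hm' hcc
    by_contra hmm
    have hm : m ∈ G := hm
    have hm' : m' ∈ G := hm'
    have h1 := (abs_le.1 (hc m hm (C.region m))).1
    have h2 := (abs_le.1 (hc m' hm' (C.region m))).2
    rw [hcc] at h1
    have h3 : ∑ x, U m x * mass (blockChannel W x) (C.region m)ᶜ +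
        ∑ x, U m x * mass (blockChannel W x) (C.region m) = 1 := by
      simp_rw [← Finset.sum_add_distrib, ← mul_add, mass_compl_add (blockChannel_mem hW _), mul_one]
      exact (hUmem m hm).2
    have h4 := hUle m hm (fun x => mass (blockChannel W x) (C.region m)ᶜ)
      fun x => mass_nonneg (blockChannel_mem hW x).1 _
    have h5 := hUle m' hm' (fun x => mass (blockChannel W x) (C.region m))
      fun x => mass_nonneg (blockChannel_mem hW x).1 _
    have h6 : 2 / κ * C.err1 W m ≤ 2 / κ * e₁ :=
      mul_le_mul_of_nonneg_left (he₁ m) (by positivity)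
    have h7 : 2 / κ * C.err2 W m m' ≤ 2 / κ * e₂ :=
      mul_le_mul_of_nonneg_left (he₂ m m' hmm) (by positivity)
    rw [IdCode.err1] at h6
    rw [IdCode.err2] at h7
    linarith
  have hcard : G.card ≤ (2 ^ n) ^ L := by
    have := Finset.card_le_card_of_injOn c (t := Finset.univ) (fun _ _ => Finset.mem_univ _) hinj
    simpa using this
  exact hGcard.trans (by exact_mod_cast hcard)

/-- By Markov's inequality, a bound on the mean weight of a code gives a lower bound for the mass
that its messages put on words of weight at most `b`. -/
theorem le_mass_weight_le {Y : Type*} {n : ℕ} (C : IdCode Y n) {b e κ : ℝ} (hb : 0 < b)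
    (he : ∑ x, (1 / (C.size : ℝ) * ∑ m, C.codeword m x) * (weight x : ℝ) ≤ e)
    (hκ : e ≤ (1 - κ) * b) :
    κ * C.size ≤ ∑ m, ∑ x, C.codeword m x * if (weight x : ℝ) ≤ b then 1 else 0 := by
  have hM : (0 : ℝ) < C.size := by exact_mod_cast C.size_pos
  have h1 : ∀ m x, C.codeword m x - C.codeword m x * weight x / b ≤
      C.codeword m x * if (weight x : ℝ) ≤ b then 1 else 0 := by
    intro m x
    have h0 := (C.codeword_mem m).1 x
    split_ifs with h
    · have : 0 ≤ C.codeword m x * weight x / b := by positivity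
      linarith
    · have : C.codeword m x ≤ C.codeword m x * weight x / b := by
        rw [le_div_iff₀ hb]
        exact mul_le_mul_of_nonneg_left (not_le.1 h).le h0
      linarith
  have h2 : ∑ x, (1 / (C.size : ℝ) * ∑ m, C.codeword m x) * (weight x : ℝ) =
      1 / (C.size : ℝ) * ∑ m, ∑ x, C.codeword m x * weight x := by
    rw [Finset.sum_comm, Finset.mul_sum]
    refine Finset.sum_congr rfl fun x _ => ?_
    rw [mul_assoc, Finset.sum_mul]
  have h3 := Finset.sum_le_sum fun m (_ : m ∈ Finset.univ) =>
    Finset.sum_le_sum fun x (_ : x ∈ Finset.univ) => h1 m x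
  simp_rw [Finset.sum_sub_distrib, (C.codeword_mem _).2, ← Finset.sum_div] at h3
  refine le_trans ?_ h3
  rw [h2, one_div, inv_mul_le_iff₀ hM] at he
  have h4 : (∑ m, ∑ x, C.codeword m x * (weight x : ℝ)) / b ≤ C.size * (1 - κ) := by
    rw [div_le_iff₀ hb]
    nlinarith
  simp only [Finset.sum_const, Finset.card_univ, Fintype.card_fin, nsmul_eq_mul, mul_one]
  linarith

set_option maxHeartbeats 1000000 in
theorem le_of_isAchievable {Y Z : Type*} [Fintype Y] [Fintype Z] {W : Fin 2 → Y → ℝ}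
    {V : Fin 2 → Z → ℝ} (hW : IsBinaryChannel W) (hV : IsBinaryChannel V) (hne : V 1 ≠ V 0)
    (hVac : AbsCont (V 1) (V 0)) (hWac : AbsCont (W 1) (W 0)) {δ : ℝ} (hδ : 0 < δ)
    {ν : ℕ → ℕ} (hν : StrictMono ν) {R : ℝ} (hR : IsAchievable W V δ ν R) :
    R ≤ √(2 * δ / chiSquare (V 1) (V 0)) * klDivergence (W 1) (W 0) := by
  obtain ⟨C, hrate, hcov, he1, he2, -⟩ := hR
  by_contra! hlt
  have hχ := chiSquare_pos hV hVac hne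
  have hD := klDivergence_nonneg (hW 1) (hW 0) hWac
  set D := klDivergence (W 1) (W 0) with hDdef
  set w := √(2 * δ / chiSquare (V 1) (V 0)) with hw
  have hw0 : 0 < w := Real.sqrt_pos.2 (by positivity)
  -- The words of weight at most `a √n`, with `a` slightly larger than `w`, carry a fixed proportion
  -- `2 κ` of the mass, up to lower-order terms.
  obtain ⟨a, hwa, haD⟩ : ∃ a, w < a ∧ a * D < R := by
    refine ⟨w + (R - w * D) / (2 * (D + 1)), ?_, ?_⟩
    · have : 0 < (R - w * D) / (2 * (D + 1)) := div_pos (by linarith) (by linarith)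
      linarith
    · have : (R - w * D) / (2 * (D + 1)) * D < R - w * D := by
        rw [div_mul_eq_mul_div, div_lt_iff₀ (by linarith)]
        nlinarith
      linarith
  have ha : 0 < a := hw0.trans hwa
  obtain ⟨ε, hε, hRε⟩ : ∃ ε : ℝ, 0 < ε ∧ R = a * D + 3 * ε :=
    ⟨(R - a * D) / 3, by linarith, by ring⟩
  obtain ⟨κ, hκ, hκa⟩ : ∃ κ : ℝ, 0 < κ ∧ w = (1 - 2 * κ) * a := by
    refine ⟨(1 - w / a) / 2, ?_, ?_⟩
    · have : w / a < 1 := (div_lt_one ha).2 hwa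
      linarith
    · field_simp
      ring
  obtain ⟨c₀, hc₀⟩ := exists_mean_weight_le hV hVac hne hδ
  obtain ⟨s, hs, hab⟩ := exists_mass_above_le hW hWac (η := ε / (2 * a)) (by positivity)
  have hνt : Tendsto ν atTop atTop := hν.tendsto_atTop
  have hrt : Tendsto (fun k => √(ν k : ℝ)) atTop atTop :=
    Real.tendsto_sqrt_atTop.comp (tendsto_natCast_atTop_atTop.comp hνt)
  have hev1 : ∀ᶠ k in atTop, ((a * D + 2 * ε : ℝ) : EReal) < (C k).rate := by
    refine eventually_lt_of_lt_liminf (lt_of_lt_of_le ?_ hrate)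
    rw [EReal.coe_lt_coe_iff]
    linarith
  have hev2 : ∀ᶠ r : ℝ in atTop, Real.exp (512 * r ^ 2 - 1 * Real.exp (ε * r)) < min 1 (κ / 2) :=
    (tendsto_exp_sub_exp hε one_pos).eventually_lt_const (lt_min one_pos (by positivity))
  have hev3 : ∀ᶠ r : ℝ in atTop, Real.exp (-(s * ε / 2 * r)) < 1 / 16 :=
    (tendsto_exp_neg_mul (by positivity)).eventually_lt_const (by norm_num)
  have hev4 : ∀ᶠ r : ℝ in atTop, c₀ / (κ * a) ≤ r ∧ 0 < r :=
    (eventually_ge_atTop _).and (eventually_gt_atTop 0)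
  have hev5 : ∀ᶠ k in atTop, 2 / κ * ((C k).maxErr1 W + (C k).maxErr2 W) < 1 / 2 := by
    have := (he1.add he2).const_mul (2 / κ)
    refine this.eventually_lt_const ?_
    norm_num
  obtain ⟨k, h1, h2, h3, ⟨h4, hr⟩, h5, h6⟩ := (hev1.and ((hrt.eventually hev2).and
    ((hrt.eventually hev3).and ((hrt.eventually hev4).and (hev5.and (hνt.eventually hc₀)))))).exists
  have hn : (ν k : ℝ) = √(ν k : ℝ) ^ 2 := (Real.sq_sqrt (Nat.cast_nonneg _)).symm
  set r := √(ν k : ℝ) with hrdef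
  set γ := (a * D + ε) * r with hγ
  have haD0 : 0 ≤ a * D := by positivity
  have hγ0 : 0 ≤ γ := by positivity
  set L := ⌈256 * Real.exp γ⌉₊ with hLdef
  have hL : 0 < L := Nat.ceil_pos.2 (by positivity)
  have hL1 : 256 * Real.exp γ ≤ L := Nat.le_ceil _
  have hL2 : (L : ℝ) ≤ 512 * Real.exp γ := by
    have := (Nat.ceil_lt_add_one (show 0 ≤ 256 * Real.exp γ by positivity)).le
    linarith [Real.one_le_exp hγ0]
  have hM0 : (0 : ℝ) < (C k).size := by exact_mod_cast (C k).size_pos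
  have hweight := h6 (fun x => 1 / ((C k).size : ℝ) * ∑ m, (C k).codeword m x) ?_ ?_
  rotate_left
  · refine ⟨fun x => mul_nonneg (by positivity)
      (Finset.sum_nonneg fun m _ => ((C k).codeword_mem m).1 x), ?_⟩
    rw [← Finset.mul_sum, Finset.sum_comm]
    simp [((C k).codeword_mem _).2, hM0.ne']
  · refine le_of_eq_of_le (congrArg (fun P => klDivergence P _) (funext fun z => ?_)) (hcov k)
    rw [IdCode.wardenOutput, Finset.sum_comm, Finset.mul_sum]
    refine Finset.sum_congr rfl fun x _ => ?_
    rw [mul_assoc, Finset.sum_mul]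
  have hlow := le_mass_weight_le (C k) (b := a * r) (κ := κ) (by positivity) hweight (by
    have : c₀ ≤ r * (κ * a) := (div_le_iff₀ (by positivity)).1 h4
    rw [← hw, hκa]
    linarith)
  have hcount := size_le_of_errors_le hW (C k) (b := a * r) (γ := γ) (θ := 1 / 16) (η := 1 / 16)
    (τ := 1 / 4) (e₁ := (C k).maxErr1 W) (e₂ := (C k).maxErr2 W) hκ hL (by norm_num)
    (fun m => le_ciSup (f := fun m => (C k).err1 W m) (Set.finite_range _).bddAbove m)
    (fun m m' hmm => le_ciSup
      (f := fun p : {p : Fin (C k).size × Fin (C k).size // p.1 ≠ p.2} => (C k).err2 W p.1.1 p.1.2)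
      (Set.finite_range _).bddAbove ⟨(m, m'), hmm⟩) hlow ?_ (by linarith) (by norm_num)
    (by linarith)
  swap
  · intro x hx
    refine (hab (ν k) γ x).trans (le_trans (Real.exp_le_exp.2 ?_) h3.le)
    have h7 : (weight x : ℝ) * (D + ε / (2 * a)) ≤ a * r * (D + ε / (2 * a)) := by gcongr
    have h8 : a * r * (D + ε / (2 * a)) - γ = -(ε / 2 * r) := by
      rw [hγ]
      field_simp
      ring
    have h9 : s * (weight x * (D + ε / (2 * a)) - γ) ≤ s * -(ε / 2 * r) := by
      gcongr
      linarith
    linarith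
  -- The count contradicts the doubly exponential number of messages.
  have hsize : Real.exp (Real.exp ((a * D + 2 * ε) * r)) < (C k).size := by
    rw [IdCode.rate] at h1
    split_ifs at h1 with hone
    · exact absurd h1 not_lt_bot
    · rw [EReal.coe_lt_coe_iff, lt_div_iff₀ hr] at h1
      have h2M : (1 : ℝ) < (C k).size := by
        have := (C k).size_pos
        exact_mod_cast (show 1 < (C k).size by omega)
      rw [Real.lt_log_iff_exp_lt (Real.log_pos h2M), Real.lt_log_iff_exp_lt hM0] at h1
      exact h1
  have hpow : (((2 ^ ν k) ^ L : ℕ) : ℝ) ≤ Real.exp (512 * r ^ 2 * Real.exp γ) := by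
    push_cast
    rw [← pow_mul]
    calc (2 : ℝ) ^ (ν k * L) ≤ Real.exp 1 ^ (ν k * L) := by
          gcongr
          linarith [Real.add_one_le_exp 1]
      _ = Real.exp (r ^ 2 * L) := by
          rw [← Real.exp_nat_mul, mul_one]
          push_cast
          rw [hn]
      _ ≤ Real.exp (r ^ 2 * (512 * Real.exp γ)) := by gcongr
      _ = _ := by
          congr 1
          ring
  have hneg : 512 * r ^ 2 - 1 * Real.exp (ε * r) < 0 := by
    rw [← Real.exp_lt_one_iff]
    exact h2.trans_le (min_le_left _ _)
  have hfac : Real.exp ((a * D + 2 * ε) * r) = Real.exp γ * Real.exp (ε * r) := by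
    rw [← Real.exp_add, hγ]
    congr 1
    ring
  have hkey : Real.exp (512 * r ^ 2 * Real.exp γ) * Real.exp (-(Real.exp γ * Real.exp (ε * r))) <
      κ / 2 := by
    rw [← Real.exp_add]
    refine lt_of_le_of_lt (Real.exp_le_exp.2 ?_) (h2.trans_le (min_le_right _ _))
    nlinarith [Real.one_le_exp hγ0]
  have hprod : κ / 2 * Real.exp (Real.exp γ * Real.exp (ε * r)) <
      Real.exp (512 * r ^ 2 * Real.exp γ) := by
    rw [← hfac]
    refine lt_of_lt_of_le (mul_lt_mul_of_pos_left hsize (by positivity)) (hcount.trans hpow)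
  have := mul_lt_mul_of_pos_right hprod (Real.exp_pos (-(Real.exp γ * Real.exp (ε * r))))
  rw [mul_assoc, ← Real.exp_add, add_neg_cancel, Real.exp_zero, mul_one] at this
  exact lt_asymm this hkey

end CovertID

theorem theorem1 {Y Z : Type*} [Fintype Y] [Fintype Z]
    (W : Fin 2 → Y → ℝ) (V : Fin 2 → Z → ℝ)
    (hW : CovertID.IsBinaryChannel W) (hV : CovertID.IsBinaryChannel V)
    (hne : V 1 ≠ V 0) (hVac : CovertID.AbsCont (V 1) (V 0)) (hWac : CovertID.AbsCont (W 1) (W 0))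
    (δ : ℝ) (hδ : 0 < δ) (ν : ℕ → ℕ) (hν : StrictMono ν) :
    CovertID.covertIdCapacity W V δ ν =
      ENNReal.ofReal (√(2 * δ / CovertID.chiSquare (V 1) (V 0)) *
        CovertID.klDivergence (W 1) (W 0)) := by
  refine le_antisymm (iSup₂_le fun R hR => ?_) (ENNReal.le_of_forall_nnreal_lt fun ρ hρ => ?_)
  · rw [← ENNReal.ofReal_coe_nnreal]
    exact ENNReal.ofReal_le_ofReal
      (CovertID.le_of_isAchievable hW hV hne hVac hWac hδ hν hR)
  · have hχ := CovertID.chiSquare_pos hV hVac hne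
    set w := √(2 * δ / CovertID.chiSquare (V 1) (V 0)) with hw
    set D := CovertID.klDivergence (W 1) (W 0) with hD
    have hw0 : 0 < w := Real.sqrt_pos.2 (by positivity)
    have hw2 : w ^ 2 * CovertID.chiSquare (V 1) (V 0) = 2 * δ := by
      rw [hw, Real.sq_sqrt (by positivity)]
      field_simp
    have hρ' : (ρ : ℝ) < w * D := by
      rw [← ENNReal.ofReal_coe_nnreal] at hρ
      exact (ENNReal.ofReal_lt_ofReal_iff_of_nonneg ρ.2).1 hρ
    have hD0 : 0 < D := pos_of_mul_pos_right (lt_of_le_of_lt ρ.2 hρ') hw0.le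
    -- A positive rate between `ρ` and the capacity, and a weight `t` that still supports it.
    obtain ⟨R, hρR, hRw⟩ := exists_between hρ'
    have hR0 : 0 < R := lt_of_le_of_lt ρ.2 hρR
    obtain ⟨t, hRt, htw⟩ := exists_between ((div_lt_iff₀ hD0).2 hRw)
    have ht0 : 0 < t := lt_trans (by positivity) hRt
    have hach : CovertID.IsAchievable W V δ ν ((⟨R, hR0.le⟩ : ℝ≥0) : ℝ) := by
      refine CovertID.isAchievable_of_lt hW hV hVac hWac hδ hR0 ht0 ((div_lt_iff₀ hD0).1 hRt) ?_ hν
      have : t ^ 2 * CovertID.chiSquare (V 1) (V 0) < w ^ 2 * CovertID.chiSquare (V 1) (V 0) := by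
        gcongr
      linarith
    refine le_trans ?_ (le_iSup₂ (f := fun (R : ℝ≥0) (_ : CovertID.IsAchievable W V δ ν R) =>
      (R : ℝ≥0∞)) ⟨R, hR0.le⟩ hach)
    exact ENNReal.coe_le_coe.2 hρR.le
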